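/- Let $\mathfrak H$ be a real separable Hilbert space and let $X=\{X(h):h\in\mathfrak H\}$ be a centered isonormal Gaussian process over $\mathfrak H$, i.e. a family of centered, jointly Gaussian random variables on a probability space $(\Omega,\mathscr F,P)$ with $E[X(h)X(k)]=\langle h,k\rangle_{\mathfrak H}$ for all $h,k\in\mathfrak H$. For a smooth cylindrical random variable $F=f(X(\phi_1),\dots,X(\phi_n))$, with $n\ge 1$, $\phi_i\in\mathfrak H$ and $f:\mathbb R^n\to\mathbb R$ smooth with compact support, put $DF=\sum_{i=1}^n\partial_i f(X(\phi_1),\dots,X(\phi_n))\,\phi_i$. Let $\mathbb D^{1,2}\subset L^2(\Omega)$ be the closure of the set of these random variables with respect to the norm $\|F\|_{1,2}^2=E[F^2]+E[\|DF\|_{\mathfrak H}^2]$, and let $D:\mathbb D^{1,2}\to L^2(\Omega;\mathfrak H)$ be the corresponding extension of $D$ (the Malliavin derivative). For $m\ge 1$ let $J_m$ be the orthogonal projection of $L^2(\Omega)$ onto the $m$-th Wiener chaos, the closed linear span of $\{\mathrm{He}_m(X(h)):h\in\mathfrak H,\ \|h\|_{\mathfrak H}=1\}$, where $\mathrm{He}_m$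 is the $m$-th Hermite polynomial, and for $F\in L^2(\Omega)$ put $L^{-1}F=-\sum_{m\ge 1}\frac1m J_mF$ (the pseudo-inverse of the generator $L=-\sum_{m\ge0} mJ_m$ of the Ornstein-Uhlenbeck semigroup). Let $Z\in\mathbb D^{1,2}$ (not necessarily centered), and let $g(Z)=E\big(\langle DZ,-DL^{-1}Z\rangle_{\mathfrak H}\,\big|\,Z\big)$, which is an integrable random variable. Then $Z$ is Gaussian (where constants count as Gaussian random variables with variance $0$) if and only if $\mathrm{Var}(g(Z))=0$, where $\mathrm{Var}(g(Z))=E\big[(g(Z)-E[g(Z)])^2\big]\in[0,\infty]$. -/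

import Mathlib

open MeasureTheory ProbabilityTheory
open scoped RealInnerProductSpace

noncomputable section

namespace Malliavin

variable {Ω H : Type*} [MeasurableSpace Ω] [NormedAddCommGroup H] [InnerProductSpace ℝ H]

/-- `X = {X h : h ∈ H}` is a (centered) isonormal Gaussian process over `H`: a jointly Gaussian
family of centered random variables with `E[X(h) X(k)] = ⟪h, k⟫`. -/
structure IsIsonormal (X : H → Ω → ℝ) (P : Measure Ω) : Prop where
  isGaussianProcess : IsGaussianProcess X P
  centered : ∀ h, ∫ ω, X h ω ∂P = 0
  integral_mul : ∀ h k, ∫ ω, X h ω * X k ω ∂P = ⟪h, k⟫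

/-- The smooth cylindrical random variables, paired with their derivatives: the set of all
`(F, DF)` in `L²(Ω) × L²(Ω; H)` with `F = f(X(φ₁), …, X(φₙ))` and
`DF = ∑ᵢ ∂ᵢf(X(φ₁), …, X(φₙ)) φᵢ`, where `n ≥ 1`, `φᵢ ∈ H`, and `f` is a smooth function
with compact support on `ℝⁿ`. -/
def smoothCylindricalGraph (X : H → Ω → ℝ) (P : Measure Ω) : Set (Lp ℝ 2 P × Lp H 2 P) :=
  {p | ∃ (n : ℕ) (φ : Fin n → H) (f : (Fin n → ℝ) → ℝ),
    1 ≤ n ∧ ContDiff ℝ (⊤ : ℕ∞) f ∧ HasCompactSupport f ∧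
    (p.1 =ᵐ[P] fun ω => f (fun i => X (φ i) ω)) ∧
    (p.2 =ᵐ[P] fun ω =>
      ∑ i, fderiv ℝ f (fun j => X (φ j) ω) (Pi.single i 1) • φ i)}

/-- `U` is the Malliavin derivative of `F`: some sequence of smooth cylindrical random variables
`Fₖ` satisfies `Fₖ → F` in `L²(Ω)` and `DFₖ → U` in `L²(Ω; H)`. -/
def HasDeriv (X : H → Ω → ℝ) (P : Measure Ω) (F : Lp ℝ 2 P) (U : Lp H 2 P) : Prop :=
  (F, U) ∈ closure (smoothCylindricalGraph X P)

/-- The space `𝔻^{1,2}`, the closure of the smooth cylindrical random variables with respect to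
the norm `‖F‖² = E[F²] + E[‖DF‖²]`. -/
def D12 (X : H → Ω → ℝ) (P : Measure Ω) : Set (Lp ℝ 2 P) :=
  {F | ∃ U, HasDeriv X P F U}

open Classical in
/-- The Malliavin derivative `D : 𝔻^{1,2} → L²(Ω; H)`, extended by `0` outside `𝔻^{1,2}`.
For an isonormal process the operator `D` on smooth cylindrical random variables is closable, so
that the chosen element is the only one. -/
def deriv (X : H → Ω → ℝ) (P : Measure Ω) (F : Lp ℝ 2 P) : Lp H 2 P :=
  if hF : ∃ U, HasDeriv X P F U then hF.choose else 0

/-- The `m`-th Wiener chaos: the closed linear subspace of `L²(Ω)` generated by the random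
variables `Heₘ(X(h))`, `‖h‖ = 1`, where `Heₘ` is the `m`-th (probabilists') Hermite polynomial.
For `m = 0` one has `He₀ = 1` and this is the space of constants (where any `h` is allowed, so
that this also holds if `H` has no unit vector). -/
def wienerChaos (X : H → Ω → ℝ) (P : Measure Ω) (m : ℕ) : Submodule ℝ (Lp ℝ 2 P) :=
  (Submodule.span ℝ {F : Lp ℝ 2 P | ∃ h : H, (m = 0 ∨ ‖h‖ = 1) ∧
    F =ᵐ[P] fun ω => Polynomial.aeval (X h ω) (Polynomial.hermite m)}).topologicalClosure

instance (X : H → Ω → ℝ) (P : Measure Ω) (m : ℕ) : CompleteSpace (wienerChaos X P m) :=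
  inferInstanceAs (CompleteSpace (Submodule.topologicalClosure _))

/-- The orthogonal projection `Jₘ` of `L²(Ω)` onto the `m`-th Wiener chaos. -/
def chaosProj (X : H → Ω → ℝ) (P : Measure Ω) (m : ℕ) : Lp ℝ 2 P →L[ℝ] Lp ℝ 2 P :=
  (wienerChaos X P m).starProjection

/-- The pseudo-inverse `L⁻¹ F = ∑_{m ≥ 1} -(1/m) Jₘ F` of the generator `L = ∑ₘ -m Jₘ` of the
Ornstein-Uhlenbeck semigroup; the series converges in `L²(Ω)`. -/
def invL (X : H → Ω → ℝ) (P : Measure Ω) (F : Lp ℝ 2 P) : Lp ℝ 2 P :=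
  ∑' m : ℕ, (-(1 / ((m : ℝ) + 1))) • chaosProj X P (m + 1) F

/-- The random variable `g(Z) = E(⟪DZ, -D L⁻¹ Z⟫ | Z)`, the conditional expectation being taken
with respect to the σ-field generated by `Z`. -/
def gOf (X : H → Ω → ℝ) (P : Measure Ω) (Z : Ω → ℝ) (hZ : MemLp Z 2 P) : Ω → ℝ :=
  condExp (MeasurableSpace.comap Z inferInstance) P
    (fun ω => ⟪deriv X P (hZ.toLp Z) ω, -(deriv X P (invL X P (hZ.toLp Z)) ω)⟫)

end Malliavin

end

/-! Put `Q = ⟪DZ, -DL⁻¹Z⟫` and `m = E Z`, and let `ψ` be the characteristic function of `Z`.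
Everything rests on one integration by parts formula, `integral_sub_mul_exp`: `E[(Z - m) e^{itZ}] =
i t E[Q e^{itZ}]`. It turns `ψ'(t) = i E[Z e^{itZ}]` into `ψ'(t) = i m ψ(t) - t E[Q e^{itZ}]`. If
`E[Q | Z]` is a constant `c`, this is the linear equation `ψ' = (i m - c t) ψ`, whose solution with
`ψ(0) = 1` is Gaussian; `|ψ| ≤ 1` forces `c ≥ 0`. If conversely `Z` is Gaussian with variance `v`,
comparison with the known `ψ'` gives `E[(Q - v) e^{itZ}] = 0` for all `t`, and Fourier uniqueness
gives `E[Q | Z] = v`. Square integrability of `g(Z)` plays no role.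

The formula combines two facts. By `exists_deriv_invL`, `E⟪DF, -DL⁻¹Z⟫ = E[F (Z - m)]` for all `F`
in the domain of `D`; by `integral_deriv_comp_mul_inner`, `F` may be replaced by `φ(Z)`, with `φ` a
cosine or a sine. The first fact holds because the divergence of `Heₘ'(X h) h` is `m Heₘ(X h)`, by
Gaussian integration by parts and the Hermite equation. Hence each chaos consists of eigenvectors of
`-L`, and the weights `-1/m` in `L⁻¹` cancel the eigenvalues.

The σ-field of `Ω` need not be generated by `X`, so the chaoses need not span `L²(Ω)`. Their sum is
only shown to capture inner products with elements of `𝔻^{1,2}`, which suffices. -/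

noncomputable section

/-! ### Isonormal processes: linearity, independence, Gaussian integration by parts. -/

namespace Malliavin

/-- Stein's identity for the standard Gaussian measure. -/
theorem integral_id_mul_gaussianReal {u u' : ℝ → ℝ} (hu : ∀ x, HasDerivAt u (u' x) x)
    (h1 : Integrable u (gaussianReal 0 1)) (h2 : Integrable (fun x => x * u x) (gaussianReal 0 1))
    (h3 : Integrable u' (gaussianReal 0 1)) :
    ∫ x, x * u x ∂(gaussianReal 0 1) = ∫ x, u' x ∂(gaussianReal 0 1) := by
  have hv : (1 : NNReal) ≠ 0 := one_ne_zero
  have key : ∀ f : ℝ → ℝ, Integrable f (gaussianReal 0 1) ↔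
      Integrable (fun x => f x * gaussianPDFReal 0 1 x) := by
    intro f
    rw [gaussianReal_of_var_ne_zero 0 hv, gaussianPDF_def,
      integrable_withDensity_iff_integrable_smul₀' (by fun_prop) (by simp)]
    refine integrable_congr (Filter.Eventually.of_forall fun x => ?_)
    simp [ENNReal.toReal_ofReal (gaussianPDFReal_nonneg 0 1 x), mul_comm]
  have hd : ∀ x, HasDerivAt (gaussianPDFReal 0 1) (-(x * gaussianPDFReal 0 1 x)) x := by
    intro x
    rw [gaussianPDFReal_def]
    have h := (((hasDerivAt_id x).pow 2).neg.div_const 2).exp.const_mul (√(2 * Real.pi * 1))⁻¹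
    convert! h using 1
    · ext y; simp
    · simp; ring
  have h := integral_mul_deriv_eq_deriv_mul_of_integrable (u := u)
    (v := gaussianPDFReal 0 1) (u' := u') (v' := fun x => -(x * gaussianPDFReal 0 1 x))
    (fun x _ => hu x) (fun x _ => hd x)
    (by
      refine ((key _).1 h2).neg.congr (Filter.Eventually.of_forall fun x => ?_)
      simp; ring)
    ((key _).1 h3) ((key _).1 h1)
  rw [integral_gaussianReal_eq_integral_smul hv, integral_gaussianReal_eq_integral_smul hv]
  simp only [smul_eq_mul]
  have e1 : ∫ x, gaussianPDFReal 0 1 x * (x * u x) = - ∫ x, u x * -(x * gaussianPDFReal 0 1 x) := by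
    rw [← integral_neg]; congr 1; ext x; ring
  rw [e1, h, neg_neg]
  congr 1; ext x; ring

variable {Ω H : Type*} [MeasurableSpace Ω] [NormedAddCommGroup H] [InnerProductSpace ℝ H]
  {P : Measure Ω} {X : H → Ω → ℝ}

namespace IsIsonormal

theorem aemeasurable (hX : IsIsonormal X P) (h : H) : AEMeasurable (X h) P :=
  hX.isGaussianProcess.aemeasurable h

theorem memLp (hX : IsIsonormal X P) (h : H) {p : ENNReal} (hp : p ≠ ⊤) : MemLp (X h) p P :=
  (hX.isGaussianProcess.hasGaussianLaw_eval h).memLp hp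

theorem integrable_mul (hX : IsIsonormal X P) (h k : H) :
    Integrable (fun ω => X h ω * X k ω) P :=
  (hX.memLp h (p := 2) (by simp)).integrable_mul (hX.memLp k (p := 2) (by simp))

theorem covariance (hX : IsIsonormal X P) (h k : H) : cov[X h, X k; P] = ⟪h, k⟫ := by
  have := hX.isGaussianProcess.isProbabilityMeasure
  rw [covariance_eq_sub (hX.memLp h (by simp)) (hX.memLp k (by simp))]
  simp [hX.centered, hX.integral_mul]

theorem map_eq (hX : IsIsonormal X P) {h : H} (hh : ‖h‖ = 1) :
    P.map (X h) = gaussianReal 0 1 := by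
  rw [(hX.isGaussianProcess.hasGaussianLaw_eval h).map_eq_gaussianReal, hX.centered,
    ← covariance_self (hX.aemeasurable h), hX.covariance]
  simp [hh]

/-- Linearity is not part of the definition. It is forced by the covariance: expanding the square
shows that the difference of the two sides has second moment zero. -/
theorem ae_add_smul (hX : IsIsonormal X P) (h k : H) (c : ℝ) :
    X (h + c • k) =ᵐ[P] fun ω => X h ω + c * X k ω := by
  have hi := hX.integrable_mul
  set s := h + c • k with hs
  have h0 : ∫ ω, (X s ω - (X h ω + c * X k ω)) ^ 2 ∂P = 0 := by
    have : (fun ω => (X s ω - (X h ω + c * X k ω)) ^ 2) = fun ω =>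
        X s ω * X s ω - 2 * (X s ω * X h ω) - (2 * c) * (X s ω * X k ω)
        + X h ω * X h ω + (2 * c) * (X h ω * X k ω) + (c ^ 2) * (X k ω * X k ω) := by
      ext ω; ring
    rw [this, integral_add, integral_add, integral_add, integral_sub, integral_sub]
    · simp only [integral_const_mul, hX.integral_mul]
      simp only [hs, inner_add_left, inner_add_right, inner_smul_left, inner_smul_right,
        real_inner_comm h k, RCLike.conj_to_real]
      ring
    all_goals
      have h1 := (hi s h).const_mul 2
      have h2 := (hi s k).const_mul (2 * c)
      have h3 := (hi h k).const_mul (2 * c)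
      have h4 := (hi k k).const_mul (c ^ 2)
      have h5 := hi s s
      have h6 := hi h h
      first
        | assumption
        | exact h5.sub h1
        | exact (h5.sub h1).sub h2
        | exact ((h5.sub h1).sub h2).add h6
        | exact (((h5.sub h1).sub h2).add h6).add h3
  have hm : MemLp (fun ω => X s ω - (X h ω + c * X k ω)) 2 P :=
    (hX.memLp s (by simp)).sub ((hX.memLp h (by simp)).add ((hX.memLp k (by simp)).const_mul c))
  rw [integral_eq_zero_iff_of_nonneg (fun ω => sq_nonneg _) hm.integrable_sq] at h0
  filter_upwards [h0] with ω hω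
  have := pow_eq_zero_iff (two_ne_zero) |>.1 hω
  linarith

theorem ae_zero (hX : IsIsonormal X P) : X 0 =ᵐ[P] 0 := by
  filter_upwards [hX.ae_add_smul 0 0 1] with ω hω
  simp at hω
  simpa using hω

theorem ae_smul (hX : IsIsonormal X P) (k : H) (c : ℝ) :
    X (c • k) =ᵐ[P] fun ω => c * X k ω := by
  filter_upwards [hX.ae_add_smul 0 k c, hX.ae_zero] with ω hω h0
  simpa [h0] using hω

theorem ae_sum (hX : IsIsonormal X P) {ι : Type*} (s : Finset ι) (c : ι → ℝ) (φ : ι → H) :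
    X (∑ i ∈ s, c i • φ i) =ᵐ[P] fun ω => ∑ i ∈ s, c i * X (φ i) ω := by
  classical
  induction s using Finset.induction_on with
  | empty => simpa using! hX.ae_zero
  | insert a s ha ih =>
    rw [Finset.sum_insert ha, add_comm]
    filter_upwards [hX.ae_add_smul (∑ i ∈ s, c i • φ i) (φ a) (c a), ih] with ω h1 h2
    rw [h1, h2, Finset.sum_insert ha, add_comm]

/-- The random variable `X h` is independent of any family indexed by vectors
orthogonal to `h`. -/
theorem indepFun_orthogonal (hX : IsIsonormal X P) {ι : Type*} (h : H) (ψ : ι → H)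
    (hψ : ∀ i, ⟪h, ψ i⟫ = 0) : IndepFun (X h) (fun ω i => X (ψ i) ω) P := by
  have h1 : IsGaussianProcess (Sum.elim (fun _ : Unit => X h) (fun i => X (ψ i))) P := by
    have := hX.isGaussianProcess.comp_right (Sum.elim (fun _ : Unit => h) ψ)
    convert! this using 1
    ext i; cases i <;> rfl
  have h2 := h1.indepFun_of_covariance_eq_zero (fun _ => hX.aemeasurable _)
    (fun _ => hX.aemeasurable _) (fun _ i => by rw [hX.covariance, hψ])
  exact h2.comp (φ := fun x : Unit → ℝ => x ()) (measurable_pi_apply _) measurable_id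

/-- Gaussian integration by parts in the direction of a unit vector. -/
theorem integral_mul_eq_integral_fderiv (hX : IsIsonormal X P) {ι : Type*} [Fintype ι] {h : H}
    (hh : ‖h‖ = 1) (φ : ι → H) {f : (ι → ℝ) → ℝ} (hf : ContDiff ℝ 1 f)
    (h1 : Integrable (fun ω => f (fun i => X (φ i) ω)) P)
    (h2 : Integrable (fun ω => X h ω * f (fun i => X (φ i) ω)) P)
    (h3 : Integrable (fun ω => fderiv ℝ f (fun i => X (φ i) ω) (fun i => ⟪φ i, h⟫)) P) :
    ∫ ω, X h ω * f (fun i => X (φ i) ω) ∂P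
      = ∫ ω, fderiv ℝ f (fun i => X (φ i) ω) (fun i => ⟪φ i, h⟫) ∂P := by
  have := hX.isGaussianProcess.isProbabilityMeasure
  -- Each `φ i` splits into its component along `h` and a remainder `ψ i` orthogonal to `h`. The
  -- vector `X(φ)` becomes `X(h) v + Y` with `Y` independent of `X(h)`, so that for fixed `Y` only
  -- the one-dimensional Stein identity along the line `x ↦ x • v + Y` is needed.
  set v : ι → ℝ := fun i => ⟪φ i, h⟫ with hv
  set ψ : ι → H := fun i => φ i - ⟪φ i, h⟫ • h with hψd
  have hψ : ∀ i, ⟪h, ψ i⟫ = 0 := by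
    intro i
    simp [hψd, inner_sub_right, inner_smul_right, hh, real_inner_comm]
  set Y : Ω → ι → ℝ := fun ω i => X (ψ i) ω with hY
  have hYm : AEMeasurable Y P := aemeasurable_pi_lambda _ fun i => hX.aemeasurable _
  have hind := hX.indepFun_orthogonal h ψ hψ
  have hlaw : P.map (fun ω => (X h ω, Y ω)) = (gaussianReal 0 1).prod (P.map Y) := by
    rw [(indepFun_iff_map_prod_eq_prod_map_map (hX.aemeasurable h) hYm).1 hind, hX.map_eq hh]
  have hνp : IsProbabilityMeasure (P.map Y) := Measure.isProbabilityMeasure_map hYm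
  have hdec : ∀ᵐ ω ∂P, (fun i => X (φ i) ω) = X h ω • v + Y ω := by
    have : ∀ i, ∀ᵐ ω ∂P, X (φ i) ω = X h ω * v i + Y ω i := by
      intro i
      have := hX.ae_add_smul (ψ i) h ⟪φ i, h⟫
      simp only [hψd, sub_add_cancel] at this
      filter_upwards [this] with ω hω
      rw [hω]; simp [hv, hY, hψd]; ring
    filter_upwards [ae_all_iff.2 this] with ω hω
    ext i; simp [hω i]
  have hpm : AEMeasurable (fun ω => (X h ω, Y ω)) P := (hX.aemeasurable h).prodMk hYm
  have hfc : Continuous f := hf.continuous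
  have hdc : Continuous (fderiv ℝ f) := hf.continuous_fderiv one_ne_zero
  have trans : ∀ (G : ℝ → (ι → ℝ) → ℝ), Continuous (fun p : ℝ × (ι → ℝ) => G p.1 p.2) →
      Integrable (fun ω => G (X h ω) (fun i => X (φ i) ω)) P →
      Integrable (fun p : ℝ × (ι → ℝ) => G p.1 (p.1 • v + p.2)) ((gaussianReal 0 1).prod (P.map Y)) ∧
      ∫ ω, G (X h ω) (fun i => X (φ i) ω) ∂P = ∫ y, ∫ x, G x (x • v + y) ∂(gaussianReal 0 1)
        ∂(P.map Y) := by
    intro G hG hi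
    have hGc : Continuous (fun p : ℝ × (ι → ℝ) => G p.1 (p.1 • v + p.2)) :=
      hG.comp (f := fun p : ℝ × (ι → ℝ) => (p.1, p.1 • v + p.2)) (by fun_prop)
    have hae : (fun ω => G (X h ω) (fun i => X (φ i) ω)) =ᵐ[P]
        fun ω => (fun p : ℝ × (ι → ℝ) => G p.1 (p.1 • v + p.2)) (X h ω, Y ω) := by
      filter_upwards [hdec] with ω hω
      simp only [hω]
    have hint : Integrable (fun p : ℝ × (ι → ℝ) => G p.1 (p.1 • v + p.2))
        ((gaussianReal 0 1).prod (P.map Y)) := by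
      rw [← hlaw, integrable_map_measure hGc.aestronglyMeasurable hpm]
      exact hi.congr hae
    refine ⟨hint, ?_⟩
    rw [integral_congr_ae hae, ← integral_map hpm hGc.aestronglyMeasurable, hlaw,
      integral_prod_symm _ hint]
  obtain ⟨i1, -⟩ := trans (fun _ z => f z) (by fun_prop) h1
  obtain ⟨i2, e2⟩ := trans (fun x z => x * f z) (by fun_prop) h2
  obtain ⟨i3, e3⟩ := trans (fun _ z => fderiv ℝ f z v) (by fun_prop) h3
  rw [e2, e3]
  refine integral_congr_ae ?_
  filter_upwards [i1.prod_left_ae, i2.prod_left_ae, i3.prod_left_ae] with y j1 j2 j3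
  refine integral_id_mul_gaussianReal (u := fun x => f (x • v + y)) (fun x => ?_) j1 j2 j3
  have := (hf.differentiable one_ne_zero (x • v + y)).hasFDerivAt
  refine this.comp_hasDerivAt x ?_
  simpa using! ((hasDerivAt_id x).smul_const v).add_const y

end IsIsonormal

end Malliavin

/-! ### Fourier uniqueness, product rule, and totality of polynomials. -/

namespace Malliavin

/-- A random variable `R` whose signed law along `Y` has vanishing Fourier transform is orthogonal
to all bounded functions of `Y`. -/
theorem integral_mul_comp_eq_zero_of_charFunDual {Ω E : Type*} [MeasurableSpace Ω] {P : Measure Ω}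
    [NormedAddCommGroup E] [NormedSpace ℝ E] [CompleteSpace E] [SecondCountableTopology E]
    [MeasurableSpace E] [BorelSpace E] {R : Ω → ℝ} (hR : Integrable R P) {Y : Ω → E}
    (hY : AEMeasurable Y P)
    (h : ∀ L : StrongDual ℝ E, ∫ ω, (R ω : ℂ) * Complex.exp (L (Y ω) * Complex.I) ∂P = 0)
    {f : E → ℝ} (hf : Measurable f) {C : ℝ} (hC : ∀ x, ‖f x‖ ≤ C) :
    ∫ ω, R ω * f (Y ω) ∂P = 0 := by
  have hm : ∀ S : Ω → ℝ, Integrable S P →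
      AEMeasurable (fun ω => ENNReal.ofReal (S ω)) P := fun S hS =>
    hS.aestronglyMeasurable.aemeasurable.ennreal_ofReal
  -- `ENNReal.ofReal` truncates at zero, so `μ R` and `μ (-R)` are the images under `Y` of the
  -- positive and negative parts of the signed measure `R P`. Both are finite measures, and the
  -- hypothesis says that their characteristic functions agree.
  set μ : (Ω → ℝ) → Measure E := fun S => (P.withDensity fun ω => ENNReal.ofReal (S ω)).map Y
    with hμ
  have hfin : ∀ S : Ω → ℝ, Integrable S P → IsFiniteMeasure (μ S) := fun S hS => by
    have := isFiniteMeasure_withDensity_ofReal hS.2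
    rw [hμ]; infer_instance
  have hac : ∀ S : Ω → ℝ, AEMeasurable Y (P.withDensity fun ω => ENNReal.ofReal (S ω)) :=
    fun S => hY.mono_ac (withDensity_absolutelyContinuous _ _)
  have hint : ∀ (V : Type) [NormedAddCommGroup V] [NormedSpace ℝ V] [SecondCountableTopology V]
      [MeasurableSpace V] [BorelSpace V] (S : Ω → ℝ) (_ : Integrable S P) (g : E → V)
      (_ : Measurable g), ∫ x, g x ∂(μ S) = ∫ ω, (max (S ω) 0) • g (Y ω) ∂P := by
    intro V _ _ _ _ _ S hS g hg
    rw [hμ, integral_map (hac S) hg.aestronglyMeasurable,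
      integral_withDensity_eq_integral_toReal_smul₀ (hm S hS) (by simp)]
    simp only [ENNReal.toReal_ofReal']
  have split : ∀ (V : Type) [NormedAddCommGroup V] [NormedSpace ℝ V] [SecondCountableTopology V]
      [MeasurableSpace V] [BorelSpace V] (g : E → V)
      (_ : Measurable g) (C : ℝ) (_ : ∀ x, ‖g x‖ ≤ C),
      ∫ x, g x ∂(μ R) - ∫ x, g x ∂(μ (-R)) = ∫ ω, R ω • g (Y ω) ∂P := by
    intro V _ _ _ _ _ g hg C hC
    rw [hint V R hR g hg, hint V (-R) hR.neg g hg, ← integral_sub]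
    · congr 1; ext ω
      rw [← sub_smul]
      congr 1
      rcases le_total 0 (R ω) with h0 | h0 <;> simp [h0]
    · exact hR.pos_part.smul_bdd C (hg.comp_aemeasurable hY).aestronglyMeasurable
        (Filter.Eventually.of_forall fun ω => hC _)
    · exact hR.neg.pos_part.smul_bdd C (hg.comp_aemeasurable hY).aestronglyMeasurable
        (Filter.Eventually.of_forall fun ω => hC _)
  have := hfin R hR
  have := hfin (-R) hR.neg
  have heq : μ R = μ (-R) := by
    refine Measure.ext_of_charFunDual (funext fun L => ?_)
    rw [charFunDual_apply, charFunDual_apply, ← sub_eq_zero]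
    rw [split ℂ (fun v => Complex.exp (L v * Complex.I)) (by fun_prop) 1
      (fun x => (Complex.norm_exp_ofReal_mul_I _).le)]
    simpa using h L
  have := split ℝ f hf C hC
  rw [heq, sub_self] at this
  simpa using this.symm

variable {Ω H : Type*} [MeasurableSpace Ω] [NormedAddCommGroup H] [InnerProductSpace ℝ H]
  {P : Measure Ω} {X : H → Ω → ℝ}

namespace IsIsonormal

theorem aemeasurable_pi (hX : IsIsonormal X P) {ι : Type*} [Fintype ι] (φ : ι → H) :
    AEMeasurable (fun ω i => X (φ i) ω) P :=
  aemeasurable_pi_lambda _ fun _ => hX.aemeasurable _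

/-- Gaussian integration by parts for a product, one of the factors being cylindrical. -/
theorem integral_fderiv_mul (hX : IsIsonormal X P) {ι κ : Type*} [Fintype ι] [Fintype κ] {h : H}
    (hh : ‖h‖ = 1) (φ : ι → H) (ψ : κ → H) {f : (ι → ℝ) → ℝ} {g : (κ → ℝ) → ℝ}
    (hf : ContDiff ℝ 1 f) (hfs : HasCompactSupport f) (hg : ContDiff ℝ 1 g)
    (h1 : Integrable (fun ω => g (fun i => X (ψ i) ω)) P)
    (h2 : Integrable (fun ω => X h ω * g (fun i => X (ψ i) ω)) P)
    (h3 : Integrable (fun ω => fderiv ℝ g (fun i => X (ψ i) ω) (fun i => ⟪ψ i, h⟫)) P) :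
    ∫ ω, fderiv ℝ f (fun i => X (φ i) ω) (fun i => ⟪φ i, h⟫) * g (fun i => X (ψ i) ω) ∂P
      = ∫ ω, f (fun i => X (φ i) ω) * (X h ω * g (fun i => X (ψ i) ω)
          - fderiv ℝ g (fun i => X (ψ i) ω) (fun i => ⟪ψ i, h⟫)) ∂P := by
  obtain ⟨C, hC⟩ := hf.continuous.bounded_above_of_compact_support hfs
  obtain ⟨D, hD⟩ := (hf.continuous_fderiv one_ne_zero).bounded_above_of_compact_support
    (hfs.fderiv (𝕜 := ℝ))
  have mφ := hX.aemeasurable_pi φ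
  have hcf := hf.continuous
  have hdf := hf.continuous_fderiv one_ne_zero
  have mf : AEStronglyMeasurable (fun ω => f (fun i => X (φ i) ω)) P :=
    (hcf.measurable.comp_aemeasurable mφ).aestronglyMeasurable
  have mdf : AEStronglyMeasurable
      (fun ω => fderiv ℝ f (fun i => X (φ i) ω) (fun i => ⟪φ i, h⟫)) P :=
    ((show Continuous fun z => fderiv ℝ f z (fun i => ⟪φ i, h⟫) by
      fun_prop).measurable.comp_aemeasurable mφ).aestronglyMeasurable
  have bf : ∀ᵐ ω ∂P, ‖f (fun i => X (φ i) ω)‖ ≤ C := Filter.Eventually.of_forall fun ω => hC _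
  have bdf : ∀ᵐ ω ∂P, ‖fderiv ℝ f (fun i => X (φ i) ω) (fun i => ⟪φ i, h⟫)‖
      ≤ D * ‖(fun i => ⟪φ i, h⟫ : ι → ℝ)‖ := Filter.Eventually.of_forall fun ω =>
    (ContinuousLinearMap.le_opNorm _ _).trans (by gcongr; exact hD _)
  -- The product is a single function of the joint family indexed by `ι ⊕ κ`, so the formula for one
  -- function applies; the product rule then splits its derivative.
  set A : (ι ⊕ κ → ℝ) →L[ℝ] (ι → ℝ) := .pi fun i => .proj (Sum.inl i) with hA
  set B : (ι ⊕ κ → ℝ) →L[ℝ] (κ → ℝ) := .pi fun i => .proj (Sum.inr i) with hB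
  set F : (ι ⊕ κ → ℝ) → ℝ := fun z => f (A z) * g (B z) with hF
  have hFd : ContDiff ℝ 1 F := (hf.comp A.contDiff).mul (hg.comp B.contDiff)
  have hder : ∀ z v, fderiv ℝ F z v =
      f (A z) * fderiv ℝ g (B z) (B v) + fderiv ℝ f (A z) (A v) * g (B z) := by
    intro z v
    have e1 := ((hf.differentiable one_ne_zero (A z)).hasFDerivAt).comp z A.hasFDerivAt
    have e2 := ((hg.differentiable one_ne_zero (B z)).hasFDerivAt).comp z B.hasFDerivAt
    have e3 : fderiv ℝ F z = _ := (e1.mul e2).fderiv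
    rw [e3]
    simp; ring
  have i1 := h1.bdd_mul mf bf
  have i2 := h2.bdd_mul mf bf
  have i3 := h3.bdd_mul mf bf
  have i4 := h1.bdd_mul mdf bdf
  have key := hX.integral_mul_eq_integral_fderiv hh (Sum.elim φ ψ) hFd
    (i1.congr (Filter.Eventually.of_forall fun ω => by simp [hF, hA, hB]))
    (i2.congr (Filter.Eventually.of_forall fun ω => by simp [hF, hA, hB]; ring))
    ((i3.add i4).congr (Filter.Eventually.of_forall fun ω => by simp [hder, hA, hB]))
  have e1 : ∀ ω, X h ω * F (fun i => X (Sum.elim φ ψ i) ω) =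
      f (fun i => X (φ i) ω) * (X h ω * g (fun i => X (ψ i) ω)) := fun ω => by
    simp [hF, hA, hB]; ring
  have e2 : ∀ ω, fderiv ℝ F (fun i => X (Sum.elim φ ψ i) ω) (fun i => ⟪Sum.elim φ ψ i, h⟫) =
      f (fun i => X (φ i) ω) * fderiv ℝ g (fun i => X (ψ i) ω) (fun i => ⟪ψ i, h⟫) +
      fderiv ℝ f (fun i => X (φ i) ω) (fun i => ⟪φ i, h⟫) * g (fun i => X (ψ i) ω) := fun ω => by
    simp [hder, hA, hB]
  simp only [e1, e2] at key
  rw [integral_add i3 i4] at key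
  simp only [mul_sub]
  rw [integral_sub i2 i3, key]
  ring

theorem integrable_polynomial (hX : IsIsonormal X P) (p : Polynomial ℝ) (h : H) :
    Integrable (fun ω => p.eval (X h ω)) P := by
  have := hX.isGaussianProcess.isProbabilityMeasure
  simp only [Polynomial.eval_eq_sum_range]
  refine integrable_finsetSum _ fun n _ => Integrable.const_mul ?_ _
  have h1 : MemLp (X h) (n : ENNReal) P := hX.memLp h (by simp)
  refine h1.integrable_norm_pow'.mono ?_ ?_
  · exact (hX.aemeasurable h).pow_const n |>.aestronglyMeasurable
  · exact Filter.Eventually.of_forall fun ω => by simp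

theorem memLp_polynomial (hX : IsIsonormal X P) (p : Polynomial ℝ) (h : H) :
    MemLp (fun ω => p.eval (X h ω)) 2 P := by
  rw [memLp_two_iff_integrable_sq (hX.integrable_polynomial p h).aestronglyMeasurable]
  exact (hX.integrable_polynomial (p ^ 2) h).congr (Filter.Eventually.of_forall fun ω => by simp)

/-- Provides the domination for the power series of `e^{iX(h)}`. The square is at most `e^{2X(h)} +
e^{-2X(h)}`, which is integrable for a Gaussian variable. -/
theorem memLp_exp_abs (hX : IsIsonormal X P) (h : H) :
    MemLp (fun ω => Real.exp |X h ω|) 2 P := by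
  have hm : AEStronglyMeasurable (fun ω => Real.exp |X h ω|) P :=
    (show Continuous fun x : ℝ => Real.exp |x| by fun_prop).measurable.comp_aemeasurable
      (hX.aemeasurable h) |>.aestronglyMeasurable
  rw [memLp_two_iff_integrable_sq hm]
  have hexp : ∀ t : ℝ, Integrable (fun ω => Real.exp (t * X h ω)) P := by
    intro t
    have h1 := (hX.isGaussianProcess.hasGaussianLaw_eval h).map_eq_gaussianReal
    have h2 := integrable_exp_mul_gaussianReal (μ := ∫ ω, X h ω ∂P) (v := Var[X h; P].toNNReal) t
    rw [← h1, integrable_map_measure (by fun_prop) (hX.aemeasurable h)] at h2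
    exact h2
  refine ((hexp 2).add (hexp (-2))).mono (hm.pow 2) (Filter.Eventually.of_forall fun ω => ?_)
  simp only [Pi.add_apply, ← Real.exp_nat_mul]
  rw [Real.norm_of_nonneg (Real.exp_nonneg _), Real.norm_of_nonneg (by positivity)]
  rcases abs_cases (X h ω) with ⟨h0, _⟩ | ⟨h0, _⟩ <;> rw [h0]
  · push_cast; linarith [Real.exp_nonneg (-2 * X h ω)]
  · push_cast; rw [mul_neg, ← neg_mul]; linarith [Real.exp_nonneg (2 * X h ω)]

/-- A square integrable random variable that is orthogonal to the polynomials in the `X h` is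
orthogonal to the bounded functions of the process. -/
theorem integral_mul_comp_eq_zero (hX : IsIsonormal X P) {R : Ω → ℝ} (hR : MemLp R 2 P)
    (hpoly : ∀ (h : H) (p : Polynomial ℝ), ∫ ω, R ω * p.eval (X h ω) ∂P = 0)
    {ι : Type*} [Fintype ι] (φ : ι → H) {f : (ι → ℝ) → ℝ} (hf : Measurable f) {C : ℝ}
    (hC : ∀ x, ‖f x‖ ≤ C) : ∫ ω, R ω * f (fun i => X (φ i) ω) ∂P = 0 := by
  classical
  have := hX.isGaussianProcess.isProbabilityMeasure
  -- The exponential is expanded in its power series, whose terms are monomials in `X h` and hence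
  -- orthogonal to `R`. The series is dominated by `|R| e^{|X h|}`, a product of two square
  -- integrable functions.
  have hexp : ∀ h : H, ∫ ω, (R ω : ℂ) * Complex.exp (X h ω * Complex.I) ∂P = 0 := by
    intro h
    have hs := hasSum_integral_of_dominated_convergence (μ := P)
      (F := fun (n : ℕ) ω => (R ω : ℂ) * ((X h ω * Complex.I) ^ n / (n.factorial : ℂ)))
      (f := fun ω => (R ω : ℂ) * Complex.exp (X h ω * Complex.I))
      (fun n ω => |R ω| * (|X h ω| ^ n / n.factorial)) ?_ ?_ ?_ ?_ ?_
    · refine hs.unique ?_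
      convert hasSum_zero with n
      have := hpoly h (Polynomial.X ^ n)
      have e : ∀ ω, (R ω : ℂ) * ((X h ω * Complex.I) ^ n / (n.factorial : ℂ)) =
          ((R ω * (Polynomial.X ^ n : Polynomial ℝ).eval (X h ω) : ℝ) : ℂ) *
            (Complex.I ^ n / n.factorial) := by
        intro ω; simp; ring
      simp only [e]
      rw [integral_mul_const, integral_complex_ofReal, this]
      simp
    · intro n
      have h1 := hR.aestronglyMeasurable.aemeasurable
      have h2 := hX.aemeasurable h
      exact AEMeasurable.aestronglyMeasurable (by fun_prop)
    · intro n
      refine Filter.Eventually.of_forall fun ω => ?_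
      simp
    · refine Filter.Eventually.of_forall fun ω => ?_
      exact (Real.summable_pow_div_factorial _).mul_left _
    · have e : ∀ ω, ∑' n : ℕ, |R ω| * (|X h ω| ^ n / n.factorial) = |R ω| * Real.exp |X h ω| := by
        intro ω
        rw [tsum_mul_left, Real.exp_eq_exp_ℝ, NormedSpace.exp_eq_tsum_div]
      simp only [e]
      exact hR.norm.integrable_mul (hX.memLp_exp_abs h)
    · refine Filter.Eventually.of_forall fun ω => ?_
      refine HasSum.mul_left _ ?_
      rw [Complex.exp_eq_exp_ℂ]
      exact NormedSpace.expSeries_div_hasSum_exp _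
  refine integral_mul_comp_eq_zero_of_charFunDual (hR.integrable (by norm_num))
    (hX.aemeasurable_pi φ) (fun L => ?_) hf hC
  -- By linearity of `X`, a linear functional of the vector `X(φ)` is again some `X h`, so
  -- one-dimensional exponentials are enough.
  rw [← hexp (∑ i, L (Pi.single i 1) • φ i)]
  refine integral_congr_ae ?_
  filter_upwards [hX.ae_sum Finset.univ (fun i => L (Pi.single i 1)) φ] with ω hω
  rw [hω]
  congr 4
  conv_lhs => rw [← L.sum_comp_single]
  refine Finset.sum_congr rfl fun i _ => ?_
  have : (Pi.single i (X (φ i) ω) : ι → ℝ) = X (φ i) ω • Pi.single i 1 := by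
    rw [← Pi.single_smul]; simp
  simp [this, mul_comm]

end IsIsonormal

end Malliavin

/-! ### The graph of the Malliavin derivative as a closed subspace. -/

namespace Malliavin

open Filter Topology in
theorem tendsto_Lp_two_of_dominated {Ω E : Type*} [MeasurableSpace Ω] {P : Measure Ω}
    [NormedAddCommGroup E] {u : ℕ → Lp E 2 P} {v : Lp E 2 P} {b : Ω → ℝ} (hb : MemLp b 2 P)
    (hu : ∀ k, ∀ᵐ ω ∂P, ‖u k ω‖ ≤ b ω)
    (hlim : ∀ᵐ ω ∂P, Tendsto (fun k => u k ω) atTop (𝓝 (v ω))) : Tendsto u atTop (𝓝 v) := by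
  rw [Lp.tendsto_Lp_iff_tendsto_eLpNorm']
  have hv : ∀ᵐ ω ∂P, ‖v ω‖ ≤ b ω := by
    filter_upwards [ae_all_iff.2 hu, hlim] with ω h1 h2
    exact le_of_tendsto h2.norm (Eventually.of_forall h1)
  have key : Tendsto (fun k => ∫⁻ ω, ‖(u k - v : Ω → E) ω‖ₑ ^ (2 : ℝ) ∂P) atTop (𝓝 0) := by
    have hbi : ∫⁻ ω, ‖(2 : ℝ) * b ω‖ₑ ^ (2 : ℝ) ∂P ≠ ⊤ := by
      have := (hb.const_mul 2).2
      have h2 := lintegral_rpow_enorm_lt_top_of_eLpNorm_lt_top (p := 2) (by norm_num) (by norm_num)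
        this
      simpa using h2.ne
    have := tendsto_lintegral_of_dominated_convergence' (μ := P)
      (F := fun k ω => ‖(u k - v : Ω → E) ω‖ₑ ^ (2 : ℝ)) (f := fun _ => 0)
      (fun ω => ‖(2 : ℝ) * b ω‖ₑ ^ (2 : ℝ)) ?_ ?_ hbi ?_
    · simpa using this
    · intro k
      exact ((Lp.aestronglyMeasurable _).sub (Lp.aestronglyMeasurable _)).enorm.pow_const _
    · intro k
      filter_upwards [hu k, hv] with ω h1 h2
      gcongr
      rw [enorm_le_iff_norm_le, Pi.sub_apply, Real.norm_eq_abs]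
      calc ‖u k ω - v ω‖ ≤ ‖u k ω‖ + ‖v ω‖ := norm_sub_le _ _
        _ ≤ 2 * b ω := by linarith
        _ ≤ _ := le_abs_self _
    · filter_upwards [hlim] with ω h
      have h1 : Tendsto (fun k => ‖u k ω - v ω‖ₑ) atTop (𝓝 0) := by
        have := (h.sub_const (v ω)).enorm
        simpa using this
      have := (ENNReal.continuous_rpow_const (y := 2)).tendsto 0 |>.comp h1
      simpa [Function.comp_def] using this
  have h2 := (ENNReal.continuous_rpow_const (y := 1 / 2)).tendsto 0 |>.comp key
  simp only [ENNReal.zero_rpow_of_pos (show (0 : ℝ) < 1 / 2 by norm_num)] at h2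
  refine h2.congr fun k => ?_
  rw [eLpNorm_eq_lintegral_rpow_enorm_toReal (by norm_num) (by norm_num)]
  simp

variable {Ω H : Type*} [MeasurableSpace Ω] [NormedAddCommGroup H] [InnerProductSpace ℝ H]
  {P : Measure Ω} {X : H → Ω → ℝ}

/-- The linear map sending the differential of a function `f` on `ℝ^ι` to `∑ i, ∂ᵢf • φ i`. -/
def gradMap {ι : Type*} [Fintype ι] [DecidableEq ι] (φ : ι → H) : ((ι → ℝ) →L[ℝ] ℝ) →L[ℝ] H :=
  ∑ i, (ContinuousLinearMap.apply ℝ ℝ (Pi.single i 1 : ι → ℝ)).smulRight (φ i)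

theorem gradMap_apply {ι : Type*} [Fintype ι] [DecidableEq ι] (φ : ι → H) (l : (ι → ℝ) →L[ℝ] ℝ) :
    gradMap φ l = ∑ i, l (Pi.single i 1) • φ i := by
  simp [gradMap]

/-- Pairing the gradient with `h` gives the directional derivative along `(⟪φ i, h⟫)ᵢ`, the
direction that appears in Gaussian integration by parts. -/
theorem inner_gradMap {ι : Type*} [Fintype ι] [DecidableEq ι] (φ : ι → H) (l : (ι → ℝ) →L[ℝ] ℝ)
    (h : H) : ⟪gradMap φ l, h⟫ = l (fun i => ⟪φ i, h⟫) := by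
  rw [gradMap_apply, sum_inner]
  conv_rhs => rw [← l.sum_comp_single]
  refine Finset.sum_congr rfl fun i _ => ?_
  have : (Pi.single i ⟪φ i, h⟫ : ι → ℝ) = ⟪φ i, h⟫ • Pi.single i 1 := by
    rw [← Pi.single_smul]; simp
  simp [this, inner_smul_left, mul_comm]

namespace IsIsonormal

theorem memLp_comp (hX : IsIsonormal X P) {n : ℕ} (φ : Fin n → H) {E : Type*}
    [NormedAddCommGroup E] {f : (Fin n → ℝ) → E} (hf : Continuous f)
    {C : ℝ} (hC : ∀ x, ‖f x‖ ≤ C) : MemLp (fun ω => f (fun i => X (φ i) ω)) 2 P := by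
  have := hX.isGaussianProcess.isProbabilityMeasure
  refine MemLp.of_bound ?_ C (Filter.Eventually.of_forall fun ω => hC _)
  exact hf.comp_aestronglyMeasurable (hX.aemeasurable_pi φ).aestronglyMeasurable

end IsIsonormal

/-- The pairs `(F, DF)` for `F = f(X(φ₁), …, X(φₙ))` with `f` smooth and `F`, `DF` square
integrable. -/
def cylGraph (X : H → Ω → ℝ) (P : Measure Ω) : Submodule ℝ (Lp ℝ 2 P × Lp H 2 P) where
  carrier := {p | ∃ (n : ℕ) (φ : Fin n → H) (f : (Fin n → ℝ) → ℝ),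
    1 ≤ n ∧ ContDiff ℝ (⊤ : ℕ∞) f ∧
    (p.1 =ᵐ[P] fun ω => f (fun i => X (φ i) ω)) ∧
    (p.2 =ᵐ[P] fun ω => gradMap φ (fderiv ℝ f (fun j => X (φ j) ω)))}
  add_mem' := by
    rintro ⟨F₁, U₁⟩ ⟨F₂, U₂⟩ ⟨n, φ, f, hn, hf, hF₁, hU₁⟩ ⟨m, ψ, g, hm, hg, hF₂, hU₂⟩
    -- The two variables are written over the concatenated family of vectors. The function `f(x) +
    -- g(y)` is in general not compactly supported, which is why the support condition is dropped
    -- from this subspace.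
    let A : (Fin (n + m) → ℝ) →L[ℝ] (Fin n → ℝ) := .pi fun i => .proj (Fin.castAdd m i)
    let B : (Fin (n + m) → ℝ) →L[ℝ] (Fin m → ℝ) := .pi fun i => .proj (Fin.natAdd n i)
    refine ⟨n + m, Fin.append φ ψ, fun z => f (A z) + g (B z), by omega,
      (hf.comp A.contDiff).add (hg.comp B.contDiff), ?_, ?_⟩
    · filter_upwards [Lp.coeFn_add F₁ F₂, hF₁, hF₂] with ω h1 h2 h3
      simp only [Prod.mk_add_mk, h1, Pi.add_apply, h2, h3]
      simp [A, B]
    · filter_upwards [Lp.coeFn_add U₁ U₂, hU₁, hU₂] with ω h1 h2 h3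
      simp only [Prod.mk_add_mk, h1, Pi.add_apply, h2, h3]
      set z : Fin (n + m) → ℝ := fun j => X (Fin.append φ ψ j) ω with hz
      have e1 := ((hf.differentiable (by simp) (A z)).hasFDerivAt).comp z A.hasFDerivAt
      have e2 := ((hg.differentiable (by simp) (B z)).hasFDerivAt).comp z B.hasFDerivAt
      have e3 : fderiv ℝ (fun z => f (A z) + g (B z)) z = _ := (e1.add e2).fderiv
      have hAz : A z = fun j => X (φ j) ω := by ext j; simp [A, hz]
      have hBz : B z = fun j => X (ψ j) ω := by ext j; simp [B, hz]
      have a1 : ∀ i, A (Pi.single (Fin.castAdd m i) 1) = Pi.single i 1 := fun i => by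
        ext j; simp [A, Pi.single_apply]
      have a2 : ∀ i, A (Pi.single (Fin.natAdd n i) 1) = 0 := fun i => by
        ext j; simp [A, Pi.single_apply, Fin.ext_iff]; omega
      have b1 : ∀ i, B (Pi.single (Fin.castAdd m i) 1) = 0 := fun i => by
        ext j; simp [B, Pi.single_apply, Fin.ext_iff]; omega
      have b2 : ∀ i, B (Pi.single (Fin.natAdd n i) 1) = Pi.single i 1 := fun i => by
        ext j; simp [B, Pi.single_apply]
      rw [e3, gradMap_apply, gradMap_apply, gradMap_apply, Fin.sum_univ_add]
      simp [a1, a2, b1, b2, hAz, hBz]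
  zero_mem' := by
    refine ⟨1, 0, 0, le_rfl, contDiff_const, ?_, ?_⟩
    · exact Lp.coeFn_zero _ _ _
    · filter_upwards [Lp.coeFn_zero H 2 P] with ω h1
      rw [Prod.snd_zero, h1]
      simp
  smul_mem' := by
    rintro c ⟨F₁, U₁⟩ ⟨n, φ, f, hn, hf, hF₁, hU₁⟩
    refine ⟨n, φ, fun z => c • f z, hn, hf.const_smul c, ?_, ?_⟩
    · filter_upwards [Lp.coeFn_smul c F₁, hF₁] with ω h1 h2
      simp only [Prod.smul_mk, h1, Pi.smul_apply, h2]
    · filter_upwards [Lp.coeFn_smul c U₁, hU₁] with ω h1 h2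
      simp only [Prod.smul_mk, h1, Pi.smul_apply, h2]
      rw [fderiv_fun_const_smul (hf.differentiable (by simp) _)]
      simp

theorem smoothCylindricalGraph_subset :
    smoothCylindricalGraph X P ⊆ (cylGraph X P : Set (Lp ℝ 2 P × Lp H 2 P)) := by
  rintro p ⟨n, φ, f, hn, hf, -, h1, h2⟩
  refine ⟨n, φ, f, hn, hf, h1, ?_⟩
  simpa only [gradMap_apply] using! h2

-- Multiplication by cut-offs `χ(r x)` with `r → 0` approximates `f` and its gradient: the
-- additional gradient term carries a factor `r`, and everything is dominated by `|F|` and `‖U‖`.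
-- This puts Hermite polynomials of `X h` into the domain of the derivative.
open Filter Topology in
theorem cylGraph_subset_closure (hX : IsIsonormal X P) :
    (cylGraph X P : Set (Lp ℝ 2 P × Lp H 2 P)) ⊆ closure (smoothCylindricalGraph X P) := by
  rintro ⟨F, U⟩ ⟨n, φ, f, hn, hf, hF, hU⟩
  simp only at hF hU
  let χ : ContDiffBump (0 : Fin n → ℝ) := ⟨1, 2, one_pos, one_lt_two⟩
  have hχ : ContDiff ℝ (⊤ : ℕ∞) χ := χ.contDiff
  have hχd : Continuous (fderiv ℝ χ) := hχ.continuous_fderiv (by simp)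
  obtain ⟨D, hD⟩ := hχd.bounded_above_of_compact_support (χ.hasCompactSupport.fderiv (𝕜 := ℝ))
  have hD0 : 0 ≤ D := (norm_nonneg _).trans (hD 0)
  have hfd : Continuous (fderiv ℝ f) := hf.continuous_fderiv (by simp)
  let r : ℕ → ℝ := fun k => 1 / ((k : ℝ) + 1)
  have hr0 : ∀ k, 0 < r k := fun k => by positivity
  have hr1 : ∀ k, r k ≤ 1 := fun k => by
    simp only [r]; rw [div_le_one (by positivity)]; linarith [(Nat.cast_nonneg k : (0:ℝ) ≤ k)]
  have hr : Tendsto r atTop (𝓝 0) := tendsto_one_div_add_atTop_nhds_zero_nat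
  let g : ℕ → (Fin n → ℝ) → ℝ := fun k x => f x * χ (r k • x)
  have hg : ∀ k, ContDiff ℝ (⊤ : ℕ∞) (g k) := fun k =>
    hf.mul (hχ.comp (contDiff_const_smul (r k)))
  have hgs : ∀ k, HasCompactSupport (g k) := fun k =>
    HasCompactSupport.mul_left (χ.hasCompactSupport.comp_smul (hr0 k).ne')
  have hgd : ∀ k x, fderiv ℝ (g k) x = f x • (r k • fderiv ℝ χ (r k • x))
      + χ (r k • x) • fderiv ℝ f x := by
    intro k x
    have e1 := (hf.differentiable (by simp) x).hasFDerivAt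
    have e2 := ((hχ.differentiable (by simp) (r k • x)).hasFDerivAt).comp x
      ((hasFDerivAt_id x).const_smul (r k))
    have e3 : fderiv ℝ (g k) x = _ := (e1.mul e2).fderiv
    rw [e3]
    ext v
    simp
  have hgdc : ∀ k, Continuous (fderiv ℝ (g k)) := fun k => (hg k).continuous_fderiv (by simp)
  have hm1 : ∀ k, MemLp (fun ω => g k (fun i => X (φ i) ω)) 2 P := fun k => by
    obtain ⟨C, hC⟩ := (hg k).continuous.bounded_above_of_compact_support (hgs k)
    exact hX.memLp_comp φ (hg k).continuous hC
  have hm2 : ∀ k, MemLp (fun ω => gradMap φ (fderiv ℝ (g k) (fun i => X (φ i) ω))) 2 P := fun k => by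
    obtain ⟨C, hC⟩ := (hgdc k).bounded_above_of_compact_support ((hgs k).fderiv (𝕜 := ℝ))
    refine hX.memLp_comp φ (f := fun x => gradMap φ (fderiv ℝ (g k) x)) (C := ‖gradMap φ‖ * C)
      (by have := hgdc k; fun_prop) fun x => ?_
    exact (ContinuousLinearMap.le_opNorm _ _).trans (by gcongr; exact hC x)
  have hlimχ : ∀ x : Fin n → ℝ, Tendsto (fun k => χ (r k • x)) atTop (𝓝 1) := fun x => by
    have h1 : Tendsto (fun k => r k • x) atTop (𝓝 0) := by simpa using hr.smul_const x
    have h2 : χ (0 : Fin n → ℝ) = 1 := χ.one_of_mem_closedBall (by simp [χ])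
    rw [← h2]
    exact (hχ.continuous.tendsto 0).comp h1
  have ht1 : Tendsto (fun k => (hm1 k).toLp) atTop (𝓝 F) := by
    refine tendsto_Lp_two_of_dominated (b := fun ω => ‖F ω‖) (Lp.memLp F).norm (fun k => ?_) ?_
    · filter_upwards [(hm1 k).coeFn_toLp, hF] with ω h1 h2
      rw [h1, h2, norm_mul]
      refine mul_le_of_le_one_right (norm_nonneg _) ?_
      rw [Real.norm_of_nonneg χ.nonneg]; exact χ.le_one
    · filter_upwards [ae_all_iff.2 fun k => (hm1 k).coeFn_toLp, hF] with ω h1 h2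
      simp only [h1, h2, g]
      simpa using (hlimχ (fun i => X (φ i) ω)).const_mul (f (fun i => X (φ i) ω))
  have ht2 : Tendsto (fun k => (hm2 k).toLp) atTop (𝓝 U) := by
    refine tendsto_Lp_two_of_dominated (b := fun ω => ‖F ω‖ * (‖gradMap φ‖ * D) + ‖U ω‖)
      (((Lp.memLp F).norm.mul_const _).add (Lp.memLp U).norm) (fun k => ?_) ?_
    · filter_upwards [(hm2 k).coeFn_toLp, hF, hU] with ω h1 h2 h3
      rw [h1, h2, h3, hgd, map_add, map_smul, map_smul, map_smul]
      refine (norm_add_le _ _).trans (add_le_add ?_ ?_)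
      · rw [norm_smul, norm_smul (r k), Real.norm_of_nonneg (hr0 k).le]
        refine mul_le_mul_of_nonneg_left ?_ (norm_nonneg _)
        refine (mul_le_of_le_one_left (norm_nonneg _) (hr1 k)).trans ?_
        exact (ContinuousLinearMap.le_opNorm _ _).trans (by gcongr; exact hD _)
      · rw [norm_smul, Real.norm_of_nonneg χ.nonneg]
        exact mul_le_of_le_one_left (norm_nonneg _) χ.le_one
    · filter_upwards [ae_all_iff.2 fun k => (hm2 k).coeFn_toLp, hU] with ω h1 h3
      rw [h3]
      refine Tendsto.congr (fun k => (h1 k).symm) ?_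
      simp only [hgd]
      set x : Fin n → ℝ := fun i => X (φ i) ω
      have l1 : Tendsto (fun k => r k • fderiv ℝ χ (r k • x)) atTop (𝓝 0) := by
        refine squeeze_zero_norm (a := fun k => r k * D) (fun k => ?_) ?_
        · change ‖r k • fderiv ℝ χ (r k • x)‖ ≤ r k * D
          rw [norm_smul, Real.norm_of_nonneg (hr0 k).le]
          exact mul_le_mul_of_nonneg_left (hD _) (hr0 k).le
        · simpa using hr.mul_const D
      have l2 := (l1.const_smul (f x)).add ((hlimχ x).smul_const (fderiv ℝ f x))
      rw [smul_zero, zero_add, one_smul] at l2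
      exact ((gradMap φ).continuous.tendsto _).comp l2
  refine mem_closure_of_tendsto (ht1.prodMk_nhds ht2) (Eventually.of_forall fun k => ?_)
  refine ⟨n, φ, g k, hn, hg k, hgs k, (hm1 k).coeFn_toLp, ?_⟩
  simpa only [gradMap_apply] using! (hm2 k).coeFn_toLp

/-- The graph of the Malliavin derivative as a closed subspace of `L²(Ω) × L²(Ω; H)`. -/
def derivGraph (X : H → Ω → ℝ) (P : Measure Ω) : Submodule ℝ (Lp ℝ 2 P × Lp H 2 P) :=
  (cylGraph X P).topologicalClosure

theorem coe_derivGraph (hX : IsIsonormal X P) :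
    (derivGraph X P : Set (Lp ℝ 2 P × Lp H 2 P)) = closure (smoothCylindricalGraph X P) :=
  (closure_minimal (cylGraph_subset_closure hX) isClosed_closure).antisymm
    (closure_mono smoothCylindricalGraph_subset)

theorem hasDeriv_iff (hX : IsIsonormal X P) {F : Lp ℝ 2 P} {U : Lp H 2 P} :
    HasDeriv X P F U ↔ (F, U) ∈ derivGraph X P := by
  rw [HasDeriv, ← coe_derivGraph hX, SetLike.mem_coe]

/-- Closed conditions need testing only on compactly supported functions, where all integrability is
automatic, although the graph is defined from the larger class. -/
theorem derivGraph_induction (hX : IsIsonormal X P) {C : Set (Lp ℝ 2 P × Lp H 2 P)}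
    (hC : IsClosed C) (h : smoothCylindricalGraph X P ⊆ C) {p : Lp ℝ 2 P × Lp H 2 P}
    (hp : p ∈ derivGraph X P) : p ∈ C := by
  rw [← SetLike.mem_coe, coe_derivGraph hX] at hp
  exact closure_minimal h hC hp

end Malliavin

/-! ### Duality, closability, and eigenvectors of the Ornstein-Uhlenbeck generator. -/

namespace Malliavin

variable {Ω H : Type*} [MeasurableSpace Ω] [NormedAddCommGroup H] [InnerProductSpace ℝ H]
  {P : Measure Ω} {X : H → Ω → ℝ}

/-- Duality relations for the Malliavin derivative extend from the smooth cylindrical random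
variables to the closure. -/
theorem inner_eq_inner_of_forall_smooth (hX : IsIsonormal X P) {A : Lp H 2 P} {B : Lp ℝ 2 P}
    (h : ∀ p ∈ smoothCylindricalGraph X P, ⟪p.2, A⟫ = ⟪p.1, B⟫)
    {p : Lp ℝ 2 P × Lp H 2 P} (hp : p ∈ derivGraph X P) : ⟪p.2, A⟫ = ⟪p.1, B⟫ :=
  derivGraph_induction hX (C := {p | ⟪p.2, A⟫ = ⟪p.1, B⟫})
    (isClosed_eq (by fun_prop) (by fun_prop)) h hp

/-- The derivative of a random variable is dual to the divergence of `g(X(ψ)) e`. -/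
theorem inner_eq_inner_divergence (hX : IsIsonormal X P) {e : H} (he : ‖e‖ = 1) {k : ℕ}
    (ψ : Fin k → H) {g : (Fin k → ℝ) → ℝ} (hg : ContDiff ℝ 1 g)
    (h1 : Integrable (fun ω => g (fun i => X (ψ i) ω)) P)
    (h2 : Integrable (fun ω => X e ω * g (fun i => X (ψ i) ω)) P)
    (h3 : Integrable (fun ω => fderiv ℝ g (fun i => X (ψ i) ω) (fun i => ⟪ψ i, e⟫)) P)
    {A : Lp H 2 P} (hA : A =ᵐ[P] fun ω => g (fun i => X (ψ i) ω) • e) {B : Lp ℝ 2 P}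
    (hB : B =ᵐ[P] fun ω => X e ω * g (fun i => X (ψ i) ω)
      - fderiv ℝ g (fun i => X (ψ i) ω) (fun i => ⟪ψ i, e⟫))
    {p : Lp ℝ 2 P × Lp H 2 P} (hp : p ∈ derivGraph X P) : ⟪p.2, A⟫ = ⟪p.1, B⟫ := by
  refine inner_eq_inner_of_forall_smooth hX ?_ hp
  rintro ⟨F, U⟩ ⟨n, φ, f, hn, hf, hfs, hF, hU⟩
  simp only at hF hU ⊢
  have key := hX.integral_fderiv_mul he φ ψ (hf.of_le (by exact_mod_cast le_top)) hfs hg h1 h2 h3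
  rw [L2.inner_def, L2.inner_def]
  refine Eq.trans (integral_congr_ae ?_) (key.trans (integral_congr_ae ?_))
  · filter_upwards [hA, hU] with ω h1 h2
    rw [h1, h2, ← gradMap_apply, inner_smul_right, inner_gradMap, mul_comm]
  · filter_upwards [hB, hF] with ω h1 h2
    simp [h1, h2, mul_comm]

/-- The Malliavin derivative is closable. -/
theorem eq_zero_of_zero_mem_derivGraph (hX : IsIsonormal X P) {U : Lp H 2 P}
    (hU : ((0 : Lp ℝ 2 P), U) ∈ derivGraph X P) : U = 0 := by
  have := hX.isGaussianProcess.isProbabilityMeasure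
  -- Duality moves the derivative from `F = 0` to the field `g(X(φ)) e`, so `U` is orthogonal to
  -- that field. The divergence formula wants a unit vector, hence the norm of `e` is absorbed into
  -- `g`.
  have step1 : ∀ (n : ℕ) (φ : Fin n → H) (g : (Fin n → ℝ) → ℝ) (_ : ContDiff ℝ 1 g)
      (_ : HasCompactSupport g) (e : H) (A : Lp H 2 P)
      (_ : A =ᵐ[P] fun ω => g (fun i => X (φ i) ω) • e), ⟪U, A⟫ = 0 := by
    intro n φ g hg hgs e A hA
    rcases eq_or_ne e 0 with rfl | he
    · have : A = 0 := by
        ext1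
        filter_upwards [hA, Lp.coeFn_zero H 2 P] with ω h1 h2
        simp [h1]
      rw [this, inner_zero_right]
    set e' := ‖e‖⁻¹ • e with he'
    have hn : ‖e‖ ≠ 0 := norm_ne_zero_iff.2 he
    have hn' : ‖e'‖ = 1 := by rw [he', norm_smul, norm_inv, norm_norm, inv_mul_cancel₀ hn]
    set g' : (Fin n → ℝ) → ℝ := fun x => ‖e‖ * g x with hg'
    have hgd' : ContDiff ℝ 1 g' := contDiff_const.mul hg
    have hgs' : HasCompactSupport g' := hgs.mul_left
    obtain ⟨C, hC⟩ := hgd'.continuous.bounded_above_of_compact_support hgs'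
    have hdc := hgd'.continuous_fderiv one_ne_zero
    obtain ⟨D, hD⟩ := hdc.bounded_above_of_compact_support (hgs'.fderiv (𝕜 := ℝ))
    have m1 := hX.memLp_comp φ hgd'.continuous hC
    have m2 : MemLp (fun ω => X e' ω * g' (fun i => X (φ i) ω)) 2 P :=
      (hX.memLp e' (p := 2) (by simp)).of_le_mul (c := C)
        ((hX.aemeasurable e').aestronglyMeasurable.mul m1.aestronglyMeasurable)
        (Filter.Eventually.of_forall fun ω => by
          rw [norm_mul, mul_comm]; gcongr; exact hC _)
    have m3 := hX.memLp_comp φ (f := fun x => fderiv ℝ g' x (fun i => ⟪φ i, e'⟫))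
      (C := D * ‖(fun i => ⟪φ i, e'⟫ : Fin n → ℝ)‖) (by fun_prop) fun x =>
        (ContinuousLinearMap.le_opNorm _ _).trans (by gcongr; exact hD x)
    have hA' : A =ᵐ[P] fun ω => g' (fun i => X (φ i) ω) • e' := by
      filter_upwards [hA] with ω h1
      rw [h1, he', hg', smul_smul]
      congr 1; field_simp
    have := inner_eq_inner_divergence hX hn' φ hgd' (m1.integrable (by norm_num))
      (m2.integrable (by norm_num)) (m3.integrable (by norm_num)) hA' (m2.sub m3).coeFn_toLp hU
    simpa using this
  -- Derivatives of smooth variables are finite sums of such fields, so `U` is orthogonal to the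
  -- whole range of the derivative, which contains `U` itself.
  have step2 : ∀ p ∈ derivGraph X P, ⟪U, p.2⟫ = 0 := by
    intro p hp
    refine derivGraph_induction hX (C := {p | ⟪U, p.2⟫ = 0})
      (isClosed_eq (by fun_prop) (by fun_prop)) ?_ hp
    rintro ⟨F, V⟩ ⟨n, φ, f, hn, hf, hfs, hF, hV⟩
    simp only at hF hV
    have hd : ∀ i, ContDiff ℝ 1 (fun x => fderiv ℝ f x (Pi.single i 1)) := fun i =>
      (hf.fderiv_right (m := 1) (by norm_cast)).clm_apply contDiff_const
    have hs : ∀ i, HasCompactSupport (fun x => fderiv ℝ f x (Pi.single i 1)) := fun i =>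
      hfs.fderiv_apply (𝕜 := ℝ) _
    have hm : ∀ i, MemLp (fun ω => fderiv ℝ f (fun j => X (φ j) ω) (Pi.single i 1) • φ i) 2 P :=
      fun i => by
        obtain ⟨C, hC⟩ := (hd i).continuous.bounded_above_of_compact_support (hs i)
        refine hX.memLp_comp φ (f := fun x => fderiv ℝ f x (Pi.single i 1) • φ i)
          (C := C * ‖φ i‖) ((hd i).continuous.smul continuous_const) fun x => ?_
        rw [norm_smul]; gcongr; exact hC x
    have hVs : V = ∑ i, (hm i).toLp := by
      ext1
      filter_upwards [hV, Lp.coeFn_finsetSum Finset.univ (fun i => (hm i).toLp),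
        ae_all_iff.2 fun i => (hm i).coeFn_toLp] with ω h1 h2 h3
      rw [h1, h2]
      simp only [Finset.sum_apply]
      exact Finset.sum_congr rfl fun i _ => (h3 i).symm
    change ⟪U, V⟫ = 0
    rw [hVs, inner_sum]
    exact Finset.sum_eq_zero fun i _ => step1 n φ _ (hd i) (hs i) (φ i) _ (hm i).coeFn_toLp
  simpa using step2 _ hU

theorem derivGraph_unique (hX : IsIsonormal X P) {F : Lp ℝ 2 P} {U V : Lp H 2 P}
    (hU : (F, U) ∈ derivGraph X P) (hV : (F, V) ∈ derivGraph X P) : U = V := by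
  have := (derivGraph X P).sub_mem hU hV
  rw [Prod.mk_sub_mk, sub_self] at this
  exact sub_eq_zero.1 (eq_zero_of_zero_mem_derivGraph hX this)

theorem deriv_eq (hX : IsIsonormal X P) {F : Lp ℝ 2 P} {U : Lp H 2 P}
    (hU : (F, U) ∈ derivGraph X P) : deriv X P F = U := by
  have h : ∃ U, HasDeriv X P F U := ⟨U, (hasDeriv_iff hX).2 hU⟩
  rw [deriv, dif_pos h]
  exact derivGraph_unique hX ((hasDeriv_iff hX).1 h.choose_spec) hU

/-- The elements `(W, DW)` of the graph of the Malliavin derivative such that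
`E⟪DF, DW⟫ = m E[F W]` for all `F`, that is, `W` is an eigenvector of `-L` for the
eigenvalue `m`. -/
def eigenGraph (X : H → Ω → ℝ) (P : Measure Ω) (m : ℕ) :
    Submodule ℝ (Lp ℝ 2 P × Lp H 2 P) where
  carrier := {p | p ∈ derivGraph X P ∧ ∀ q ∈ derivGraph X P, ⟪q.2, p.2⟫ = m * ⟪q.1, p.1⟫}
  add_mem' := fun {p p'} hp hp' => ⟨add_mem hp.1 hp'.1, fun q hq => by
    simp [inner_add_right, hp.2 q hq, hp'.2 q hq, mul_add]⟩
  zero_mem' := ⟨zero_mem _, by simp⟩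
  smul_mem' := fun c p hp => ⟨Submodule.smul_mem _ c hp.1, fun q hq => by
    simp [inner_smul_right, hp.2 q hq]; ring⟩

theorem isClosed_eigenGraph (m : ℕ) :
    IsClosed (eigenGraph X P m : Set (Lp ℝ 2 P × Lp H 2 P)) := by
  have : (eigenGraph X P m : Set (Lp ℝ 2 P × Lp H 2 P)) = (derivGraph X P : Set _) ∩
      ⋂ q ∈ derivGraph X P, {p | ⟪q.2, p.2⟫ = m * ⟪q.1, p.1⟫} := by
    ext p
    simp [eigenGraph]
  rw [this]
  exact (Submodule.isClosed_topologicalClosure _).inter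
    (isClosed_biInter fun q _ => isClosed_eq (by fun_prop) (by fun_prop))

theorem norm_sq_of_mem_eigenGraph {m : ℕ} {p : Lp ℝ 2 P × Lp H 2 P} (hp : p ∈ eigenGraph X P m) :
    ‖p.2‖ ^ 2 = m * ‖p.1‖ ^ 2 := by
  simpa using hp.2 p hp.1

/-- The usual argument for a symmetric form: the pairing of the derivatives equals both `m` and `n`
times the pairing of the variables. -/
theorem inner_eq_zero_of_mem_eigenGraph {m n : ℕ} (hmn : m ≠ n) {p q : Lp ℝ 2 P × Lp H 2 P}
    (hp : p ∈ eigenGraph X P m) (hq : q ∈ eigenGraph X P n) : ⟪p.1, q.1⟫ = 0 ∧ ⟪p.2, q.2⟫ = 0 := by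
  have h1 := hp.2 q hq.1
  have h2 := hq.2 p hp.1
  rw [real_inner_comm, real_inner_comm p.1] at h1
  have h3 : ((m : ℝ) - n) * ⟪p.1, q.1⟫ = 0 := by rw [sub_mul, ← h1, ← h2, sub_self]
  have h4 : ⟪p.1, q.1⟫ = 0 := by
    refine (mul_eq_zero.1 h3).resolve_left (sub_ne_zero.2 ?_)
    exact_mod_cast hmn
  exact ⟨h4, by rw [h2, h4, mul_zero]⟩

open Polynomial in
theorem X_mul_derivative_hermite_sub (m : ℕ) :
    (Polynomial.X : ℤ[X]) * derivative (hermite m) - derivative (derivative (hermite m)) = m * hermite m := by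
  induction m with
  | zero => simp
  | succ m ih =>
    have h1 : derivative (hermite (m + 1)) = ((m : ℤ[X]) + 1) * hermite m := by
      rw [hermite_succ, derivative_sub, derivative_mul, derivative_X, one_mul, add_sub_assoc, ih]
      ring
    rw [h1]
    have h2 : derivative (((m : ℤ[X]) + 1) * hermite m) = ((m : ℤ[X]) + 1) * derivative (hermite m) := by
      rw [derivative_mul]; simp
    rw [h2, hermite_succ]
    push_cast
    ring

theorem hasFDerivAt_polynomial_apply {ι : Type*} [Fintype ι] (q : Polynomial ℝ) (i : ι)
    (z : ι → ℝ) :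
    HasFDerivAt (fun z : ι → ℝ => q.eval (z i))
      (q.derivative.eval (z i) • (ContinuousLinearMap.proj i : (ι → ℝ) →L[ℝ] ℝ)) z :=
  HasDerivAt.comp_hasFDerivAt (h₂ := fun x => q.eval x) z (q.hasDerivAt (z i)) (hasFDerivAt_apply (𝕜 := ℝ) i z)

/-- The derivative of `Heₘ(X h)` is `Heₘ'(X h) h`, whose divergence `X(h) Heₘ'(X h) - Heₘ''(X h)`
equals `m Heₘ(X h)` by the Hermite equation. -/
theorem hermite_mem_eigenGraph (hX : IsIsonormal X P) {m : ℕ} {h : H} (hh : m = 0 ∨ ‖h‖ = 1)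
    {W : Lp ℝ 2 P} (hW : W =ᵐ[P] fun ω => Polynomial.aeval (X h ω) (Polynomial.hermite m)) :
    ∃ V, (W, V) ∈ eigenGraph X P m := by
  set q : Polynomial ℝ := (Polynomial.hermite m).map (Int.castRingHom ℝ) with hq
  have hqe : ∀ x : ℝ, Polynomial.aeval x (Polynomial.hermite m) = q.eval x := fun x => by
    rw [hq, Polynomial.eval_map, Polynomial.aeval_def]; rfl
  have hode : ∀ x : ℝ, x * q.derivative.eval x - q.derivative.derivative.eval x = m * q.eval x := by
    intro x
    have := congrArg (fun p => (p.map (Int.castRingHom ℝ)).eval x) (X_mul_derivative_hermite_sub m)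
    simpa [hq] using this
  have mV : MemLp (fun ω => q.derivative.eval (X h ω) • h) 2 P := by
    have h1 := hX.memLp_polynomial q.derivative h
    exact (h1.norm.mul_const ‖h‖).mono
      (h1.aestronglyMeasurable.smul aestronglyMeasurable_const)
      (Filter.Eventually.of_forall fun ω => by simp [norm_smul])
  have hWV : (W, mV.toLp) ∈ derivGraph X P := by
    refine Submodule.le_topologicalClosure _ ⟨1, fun _ => h, fun z => q.eval (z 0), le_rfl, ?_, ?_, ?_⟩
    · exact q.contDiff_aeval _ |>.comp (contDiff_apply ℝ ℝ 0)
    · filter_upwards [hW] with ω h1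
      rw [h1, hqe]
    · filter_upwards [mV.coeFn_toLp] with ω h1
      rw [h1, (hasFDerivAt_polynomial_apply q 0 _).fderiv, gradMap_apply]
      simp
  refine ⟨mV.toLp, hWV, fun p hp => ?_⟩
  -- For `m = 0` the vector `h` need not be a unit vector, but the derivative vanishes.
  by_cases hm : m = 0
  · have hq0 : q.derivative = 0 := by rw [hq, hm]; simp
    have : mV.toLp = 0 := by
      ext1
      filter_upwards [mV.coeFn_toLp, Lp.coeFn_zero H 2 P] with ω h1 h2
      rw [h1, h2, hq0]; simp
    simp [this, hm]
  · have he := hh.resolve_left hm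
    have hfd : ∀ z : Fin 1 → ℝ, fderiv ℝ (fun z : Fin 1 → ℝ => q.derivative.eval (z 0)) z
        (fun _ => ⟪h, h⟫) = q.derivative.derivative.eval (z 0) := fun z => by
      rw [(hasFDerivAt_polynomial_apply q.derivative 0 z).fderiv]
      simp [he]
    have := inner_eq_inner_divergence hX he (fun _ : Fin 1 => h)
      (g := fun z => q.derivative.eval (z 0)) (q.derivative.contDiff_aeval _ |>.comp (contDiff_apply ℝ ℝ 0))
      (hX.integrable_polynomial _ h)
      ((hX.integrable_polynomial (Polynomial.X * q.derivative) h).congr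
        (Filter.Eventually.of_forall fun ω => by simp))
      (by simp only [hfd]; exact hX.integrable_polynomial _ h)
      mV.coeFn_toLp (B := (m : ℝ) • W)
      (by
        filter_upwards [hW, Lp.coeFn_smul (m : ℝ) W] with ω h1 h2
        simp only [hfd, hode]
        rw [h2, Pi.smul_apply, h1, hqe]; simp) hp
    rw [this, inner_smul_right]

/-- Passage from the generators to their closed span. On the eigenspace `‖DW‖² = m ‖W‖²`, so the
projection `(W, DW) ↦ W` is bounded below and, the eigenspace being complete, has closed range. -/
theorem exists_mem_eigenGraph [CompleteSpace H] (hX : IsIsonormal X P) {m : ℕ} {W : Lp ℝ 2 P}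
    (hW : W ∈ wienerChaos X P m) : ∃ V, (W, V) ∈ eigenGraph X P m := by
  let T : eigenGraph X P m →L[ℝ] Lp ℝ 2 P :=
    (ContinuousLinearMap.fst ℝ _ _).comp (eigenGraph X P m).subtypeL
  have hcomp : CompleteSpace (eigenGraph X P m) := (isClosed_eigenGraph m).completeSpace_coe
  have hT : AntilipschitzWith (1 + m) T := by
    refine AddMonoidHomClass.antilipschitz_of_bound T fun p => ?_
    have h1 := norm_sq_of_mem_eigenGraph p.2
    change max ‖(p : Lp ℝ 2 P × Lp H 2 P).1‖ ‖(p : Lp ℝ 2 P × Lp H 2 P).2‖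
      ≤ _ * ‖(p : Lp ℝ 2 P × Lp H 2 P).1‖
    push_cast
    have hm : (0 : ℝ) ≤ m := Nat.cast_nonneg m
    refine max_le (le_mul_of_one_le_left (norm_nonneg _) (by linarith)) ?_
    refine le_of_sq_le_sq ?_ (by positivity)
    rw [h1, mul_pow]
    gcongr
    nlinarith
  have hcl := hT.isClosed_range T.uniformContinuous
  have hle : wienerChaos X P m ≤ LinearMap.range T.toLinearMap := by
    refine Submodule.topologicalClosure_minimal _ (Submodule.span_le.2 ?_) hcl
    rintro F ⟨h, hh, hF⟩
    obtain ⟨V, hV⟩ := hermite_mem_eigenGraph hX hh hF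
    exact ⟨⟨(F, V), hV⟩, rfl⟩
  obtain ⟨⟨⟨F, V⟩, hV⟩, rfl⟩ := hle hW
  exact ⟨V, hV⟩

end Malliavin

/-! ### Chaos projections and the pseudo-inverse `L⁻¹`. -/

namespace Malliavin

/-- The Hermite polynomials with real coefficients. -/
def hermiteSequence : Polynomial.Sequence ℝ where
  elems' n := (Polynomial.hermite n).map (Int.castRingHom ℝ)
  degree_eq' n := by
    rw [Polynomial.degree_map_eq_of_injective Int.cast_injective, Polynomial.degree_hermite]

theorem hermiteSequence_eval (n : ℕ) (x : ℝ) :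
    (hermiteSequence n).eval x = Polynomial.aeval x (Polynomial.hermite n) := by
  change ((Polynomial.hermite n).map (Int.castRingHom ℝ)).eval x = _
  rw [Polynomial.eval_map, Polynomial.aeval_def]; rfl

theorem span_hermiteSequence : Submodule.span ℝ (Set.range hermiteSequence) = ⊤ :=
  hermiteSequence.span fun n => by
    change IsUnit ((Polynomial.hermite n).map (Int.castRingHom ℝ)).leadingCoeff
    rw [((Polynomial.hermite_monic n).map _).leadingCoeff]
    exact isUnit_one

theorem summable_of_pairwise_inner_eq_zero {E ι : Type*} [NormedAddCommGroup E]
    [InnerProductSpace ℝ E] [CompleteSpace E] {x : ι → E}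
    (hx : Pairwise fun i j => ⟪x i, x j⟫ = 0) (hs : Summable fun i => ‖x i‖ ^ 2) : Summable x := by
  have hN : OrthogonalFamily ℝ (fun i => Submodule.span ℝ {x i})
      fun i => (Submodule.span ℝ {x i}).subtypeₗᵢ := by
    rintro i j hij ⟨v, hv⟩ ⟨w, hw⟩
    obtain ⟨a, rfl⟩ := Submodule.mem_span_singleton.1 hv
    obtain ⟨b, rfl⟩ := Submodule.mem_span_singleton.1 hw
    simp [inner_smul_left, inner_smul_right, hx hij]
  exact (hN.summable_iff_norm_sq_summable
    fun i => ⟨x i, Submodule.mem_span_singleton_self _⟩).2 hs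

variable {Ω H : Type*} [MeasurableSpace Ω] [NormedAddCommGroup H] [InnerProductSpace ℝ H]
  {P : Measure Ω} {X : H → Ω → ℝ}

omit [InnerProductSpace ℝ H] in
theorem toLp_hermite_mem_wienerChaos {m : ℕ} {h : H} (hh : m = 0 ∨ ‖h‖ = 1)
    (hm : MemLp (fun ω => (hermiteSequence m).eval (X h ω)) 2 P) :
    hm.toLp ∈ wienerChaos X P m := by
  refine Submodule.le_topologicalClosure _ (Submodule.subset_span ⟨h, hh, ?_⟩)
  filter_upwards [hm.coeFn_toLp] with ω h1
  rw [h1, hermiteSequence_eval]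

/-- Hermite polynomials span all polynomials, which settles unit vectors; other nonzero `h` are
rescaled, the scale being absorbed into `p`. For `h = 0` the variable vanishes almost surely and
only constants remain. -/
theorem integral_mul_polynomial_eq_zero (hX : IsIsonormal X P) {R : Lp ℝ 2 P}
    (hR : ∀ m, ∀ F ∈ wienerChaos X P m, ⟪F, R⟫ = 0) (h : H) (p : Polynomial ℝ) :
    ∫ ω, R ω * p.eval (X h ω) ∂P = 0 := by
  have hherm : ∀ (m : ℕ) (h : H) (_ : m = 0 ∨ ‖h‖ = 1),
      ∫ ω, R ω * (hermiteSequence m).eval (X h ω) ∂P = 0 := by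
    intro m h hh
    have hm := hX.memLp_polynomial (hermiteSequence m) h
    have := hR m _ (toLp_hermite_mem_wienerChaos hh hm)
    rw [L2.inner_def] at this
    rw [← this]
    refine integral_congr_ae ?_
    filter_upwards [hm.coeFn_toLp] with ω h1
    rw [h1]; simp
  have hunit : ∀ (h : H) (_ : ‖h‖ = 1) (p : Polynomial ℝ),
      ∫ ω, R ω * p.eval (X h ω) ∂P = 0 := by
    intro h hh p
    have hi : ∀ q : Polynomial ℝ, Integrable (fun ω => R ω * q.eval (X h ω)) P := fun q =>
      (Lp.memLp R).integrable_mul (hX.memLp_polynomial q h)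
    have hp : p ∈ Submodule.span ℝ (Set.range hermiteSequence) := by
      rw [span_hermiteSequence]; trivial
    induction hp using Submodule.span_induction with
    | mem q hq =>
      obtain ⟨m, rfl⟩ := hq
      exact hherm m h (Or.inr hh)
    | zero => simp
    | add q r _ _ hq hr =>
      simp only [Polynomial.eval_add, mul_add]
      rw [integral_add (hi q) (hi r), hq, hr, add_zero]
    | smul c q _ hq =>
      have : ∀ ω, R ω * (c • q).eval (X h ω) = c * (R ω * q.eval (X h ω)) := fun ω => by
        simp; ring
      simp only [this]
      rw [integral_const_mul, hq, mul_zero]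
  rcases eq_or_ne h 0 with rfl | hh
  · have h0 := hherm 0 (0 : H) (Or.inl rfl)
    simp only [hermiteSequence_eval, Polynomial.hermite_zero, map_one, mul_one] at h0
    have : ∀ᵐ ω ∂P, R ω * p.eval (X 0 ω) = R ω * p.eval 0 := by
      filter_upwards [hX.ae_zero] with ω hω
      rw [hω]; simp
    rw [integral_congr_ae this, integral_mul_const, h0, zero_mul]
  · have hn : ‖h‖ ≠ 0 := norm_ne_zero_iff.2 hh
    rw [← hunit (‖h‖⁻¹ • h) (by rw [norm_smul, norm_inv, norm_norm, inv_mul_cancel₀ hn])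
      (p.comp (Polynomial.C ‖h‖ * Polynomial.X))]
    refine integral_congr_ae ?_
    filter_upwards [hX.ae_smul h ‖h‖⁻¹] with ω hω
    simp [hω, hn]

/-- Such an `R` need not be zero, since `Ω` may carry randomness independent of `X`; but it is
orthogonal to polynomials in the `X h`, hence to bounded functions of the process, and so to the
domain of the derivative. -/
theorem inner_eq_zero_of_orthogonal_wienerChaos (hX : IsIsonormal X P) {R : Lp ℝ 2 P}
    (hR : ∀ m, ∀ F ∈ wienerChaos X P m, ⟪F, R⟫ = 0) {p : Lp ℝ 2 P × Lp H 2 P}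
    (hp : p ∈ derivGraph X P) : ⟪p.1, R⟫ = 0 := by
  refine derivGraph_induction hX (C := {p | ⟪p.1, R⟫ = 0})
      (isClosed_eq (by fun_prop) (by fun_prop)) ?_ hp
  rintro ⟨F, U⟩ ⟨n, φ, f, hn, hf, hfs, hF, -⟩
  simp only at hF
  obtain ⟨C, hC⟩ := hf.continuous.bounded_above_of_compact_support hfs
  change ⟪F, R⟫ = 0
  rw [L2.inner_def, ← hX.integral_mul_comp_eq_zero (Lp.memLp R)
    (fun h p => integral_mul_polynomial_eq_zero hX hR h p) φ hf.continuous.measurable hC]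
  refine integral_congr_ae ?_
  filter_upwards [hF] with ω h1
  rw [h1]; simp

omit [InnerProductSpace ℝ H] in
theorem chaosProj_mem (m : ℕ) (G : Lp ℝ 2 P) : chaosProj X P m G ∈ wienerChaos X P m :=
  Submodule.starProjection_apply_mem _ _

omit [InnerProductSpace ℝ H] in
theorem inner_chaosProj {m : ℕ} {F : Lp ℝ 2 P} (hF : F ∈ wienerChaos X P m) (G : Lp ℝ 2 P) :
    ⟪F, chaosProj X P m G⟫ = ⟪F, G⟫ := by
  have := Submodule.starProjection_inner_eq_zero (K := wienerChaos X P m) G F hF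
  rw [inner_sub_left, sub_eq_zero, real_inner_comm, real_inner_comm F] at this
  exact this.symm

variable [CompleteSpace H]

theorem orthogonalFamily_wienerChaos (hX : IsIsonormal X P) :
    OrthogonalFamily ℝ (fun m => wienerChaos X P m) fun m => (wienerChaos X P m).subtypeₗᵢ := by
  intro m n hmn v w
  obtain ⟨V, hV⟩ := exists_mem_eigenGraph hX v.2
  obtain ⟨W, hW⟩ := exists_mem_eigenGraph hX w.2
  exact (inner_eq_zero_of_mem_eigenGraph hmn hV hW).1

theorem summable_norm_sq_chaosProj (hX : IsIsonormal X P) (G : Lp ℝ 2 P) :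
    Summable fun m => ‖chaosProj X P m G‖ ^ 2 := by
  refine summable_of_sum_le (c := ‖G‖ ^ 2) (fun m => sq_nonneg _) fun s => ?_
  have h1 : ‖∑ m ∈ s, chaosProj X P m G‖ ^ 2 = ∑ m ∈ s, ‖chaosProj X P m G‖ ^ 2 :=
    (orthogonalFamily_wienerChaos hX).norm_sum (fun m => ⟨_, chaosProj_mem m G⟩) s
  have h2 : ⟪∑ m ∈ s, chaosProj X P m G, G⟫ = ∑ m ∈ s, ‖chaosProj X P m G‖ ^ 2 := by
    rw [sum_inner]
    refine Finset.sum_congr rfl fun m _ => ?_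
    rw [← inner_chaosProj (chaosProj_mem m G) G, real_inner_self_eq_norm_sq]
  -- Bessel's inequality: the partial sum `S` satisfies `⟪S, G⟫ = ‖S‖²`, so `0 ≤ ‖S - G‖² = ‖G‖² -
  -- ‖S‖²`.
  have h3 := norm_sub_sq_real (∑ m ∈ s, chaosProj X P m G) G
  nlinarith [sq_nonneg ‖(∑ m ∈ s, chaosProj X P m G) - G‖]

theorem summable_chaosProj (hX : IsIsonormal X P) (G : Lp ℝ 2 P) :
    Summable fun m => chaosProj X P m G :=
  ((orthogonalFamily_wienerChaos hX).summable_iff_norm_sq_summable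
    fun m => ⟨_, chaosProj_mem m G⟩).2 (summable_norm_sq_chaosProj hX G)

/-- The part of the chaos decomposition that is visible to `𝔻^{1,2}`. -/
theorem hasSum_inner_chaosProj (hX : IsIsonormal X P) (G : Lp ℝ 2 P) {p : Lp ℝ 2 P × Lp H 2 P}
    (hp : p ∈ derivGraph X P) : HasSum (fun m => ⟪p.1, chaosProj X P m G⟫) ⟪p.1, G⟫ := by
  have hs := (summable_chaosProj hX G).hasSum
  have hR : ∀ m, ∀ F ∈ wienerChaos X P m, ⟪F, G - ∑' m, chaosProj X P m G⟫ = 0 := by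
    intro m F hF
    have h1 := hs.mapL (innerSL ℝ F)
    have h2 := hasSum_single (f := fun k => innerSL ℝ F (chaosProj X P k G)) m fun k hk => by
      exact orthogonalFamily_wienerChaos hX hk.symm ⟨F, hF⟩ ⟨_, chaosProj_mem k G⟩
    have h3 := h1.unique h2
    simp only [innerSL_apply_apply] at h3
    rw [inner_sub_right, h3, inner_chaosProj hF, sub_self]
  have h0 := inner_eq_zero_of_orthogonal_wienerChaos hX hR hp
  rw [inner_sub_right, sub_eq_zero] at h0
  rw [h0]
  exact hs.mapL (innerSL ℝ p.1)

/-- The random variable `L⁻¹ G` is Malliavin differentiable, and `-D L⁻¹ G` represents the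
covariance with `G`. -/
theorem exists_deriv_invL (hX : IsIsonormal X P) (G : Lp ℝ 2 P) :
    ∃ V, (invL X P G, V) ∈ derivGraph X P ∧ ∀ p ∈ derivGraph X P,
      ⟪p.2, -V⟫ = ⟪p.1, G - chaosProj X P 0 G⟫ := by
  choose V hV using fun m => exists_mem_eigenGraph hX (chaosProj_mem (X := X) (m + 1) G)
  let d : ℕ → ℝ := fun m => -(1 / ((m : ℝ) + 1))
  -- The three facts serve, in order, the convergence of the series for `L⁻¹ G`, that of the
  -- derivatives (where `‖V m‖²` brings in the eigenvalue `m + 1`), and the cancellation of the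
  -- eigenvalue.
  have hd : ∀ m, d m ^ 2 ≤ 1 ∧ d m ^ 2 * ((m : ℝ) + 1) ≤ 1 ∧ d m * ((m : ℝ) + 1) = -1 := by
    intro m
    have hm : (0 : ℝ) < (m : ℝ) + 1 := by positivity
    have h1 : d m * ((m : ℝ) + 1) = -1 := by simp only [d]; field_simp
    have h2 : (1 : ℝ) ≤ (m : ℝ) + 1 := by simp
    have h3 : |d m| ≤ 1 := by
      simp only [d, abs_neg]
      rw [abs_of_pos (by positivity), div_le_one hm]; exact h2
    refine ⟨by rwa [sq_le_one_iff_abs_le_one], ?_, h1⟩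
    rw [pow_two, mul_assoc, h1, mul_neg_one]
    exact (neg_le_abs _).trans h3
  have hsq : Summable fun m => ‖chaosProj X P (m + 1) G‖ ^ 2 :=
    (summable_nat_add_iff 1).2 (summable_norm_sq_chaosProj hX G)
  have hs1 : Summable fun m => d m • chaosProj X P (m + 1) G := by
    refine summable_of_pairwise_inner_eq_zero (fun m n hmn => ?_) ?_
    · have := (inner_eq_zero_of_mem_eigenGraph (by simpa using hmn) (hV m) (hV n)).1
      simp only at this
      simp [inner_smul_left, inner_smul_right, this]
    refine Summable.of_nonneg_of_le (fun m => sq_nonneg _) (fun m => ?_) hsq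
    rw [norm_smul, mul_pow, Real.norm_eq_abs, sq_abs]
    exact mul_le_of_le_one_left (sq_nonneg _) (hd m).1
  have hs2 : Summable fun m => d m • V m := by
    refine summable_of_pairwise_inner_eq_zero (fun m n hmn => ?_) ?_
    · have := (inner_eq_zero_of_mem_eigenGraph (by simpa using hmn) (hV m) (hV n)).2
      simp only at this
      simp [inner_smul_left, inner_smul_right, this]
    refine Summable.of_nonneg_of_le (fun m => sq_nonneg _) (fun m => ?_) hsq
    have h1 := norm_sq_of_mem_eigenGraph (hV m)
    simp only [Nat.cast_add, Nat.cast_one] at h1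
    rw [norm_smul, mul_pow, Real.norm_eq_abs, sq_abs, h1, ← mul_assoc]
    exact mul_le_of_le_one_left (sq_nonneg _) (hd m).2.1
  refine ⟨∑' m, d m • V m, ?_, fun p hp => ?_⟩
  · have hmem : ∀ m, d m • (chaosProj X P (m + 1) G, V m) ∈ derivGraph X P := fun m =>
      Submodule.smul_mem _ _ (hV m).1
    refine (Submodule.isClosed_topologicalClosure (cylGraph X P)).mem_of_tendsto
      (hs1.hasSum.prodMk hs2.hasSum) (Filter.Eventually.of_forall fun s => ?_)
    exact Submodule.sum_mem _ fun m _ => hmem m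
  · have h1 := hs2.hasSum.mapL (innerSL ℝ p.2)
    -- Removing the term of index zero, absent from `L⁻¹`, produces the correction `G - J₀ G`.
    have h2 := (hasSum_nat_add_iff' 1).2 (hasSum_inner_chaosProj hX G hp)
    have h3 : ∀ m, innerSL ℝ p.2 (d m • V m) = -⟪p.1, chaosProj X P (m + 1) G⟫ := by
      intro m
      rw [innerSL_apply_apply, inner_smul_right, (hV m).2 p hp]
      push_cast
      rw [← mul_assoc, (hd m).2.2, neg_one_mul]
    simp only [h3] at h1
    have h4 := h1.unique h2.neg
    rw [innerSL_apply_apply] at h4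
    rw [inner_neg_right, h4, neg_neg, inner_sub_right]
    simp

end Malliavin

/-! ### Stein's equation for the characteristic function. -/

namespace Malliavin

section Stein

variable {Ω : Type*} [MeasurableSpace Ω] {P : Measure Ω}

theorem hasDerivAt_charFun {μ : Measure ℝ} [IsFiniteMeasure μ] (hμ : MemLp id 1 μ) (t : ℝ) :
    HasDerivAt (charFun μ) (Complex.I * ∫ x, x * Complex.exp (t * x * Complex.I) ∂μ) t := by
  have h1 : ContDiff ℝ 1 (charFun μ) := contDiff_charFun (n := 1) (by simpa using hμ)
  have h2 := (h1.differentiable one_ne_zero t).hasDerivAt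
  have h3 := iteratedDeriv_charFun (n := 1) (t := t) (by simpa using hμ)
  rw [iteratedDeriv_one] at h3
  rw [h3] at h2
  simpa using h2

theorem integral_ofReal_mul_exp {S Z : Ω → ℝ} (hS : Integrable S P) (hZ : Measurable Z) (t : ℝ) :
    ∫ ω, (S ω : ℂ) * Complex.exp (t * Z ω * Complex.I) ∂P =
      (∫ ω, S ω * Real.cos (t * Z ω) ∂P : ℝ) +
        (∫ ω, S ω * Real.sin (t * Z ω) ∂P : ℝ) * Complex.I := by
  have hc : Integrable (fun ω => S ω * Real.cos (t * Z ω)) P :=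
    hS.mul_bdd (c := 1) (by fun_prop) (Filter.Eventually.of_forall fun ω => Real.abs_cos_le_one _)
  have hs : Integrable (fun ω => S ω * Real.sin (t * Z ω)) P :=
    hS.mul_bdd (c := 1) (by fun_prop) (Filter.Eventually.of_forall fun ω => Real.abs_sin_le_one _)
  rw [← integral_complex_ofReal, ← integral_complex_ofReal, ← integral_mul_const,
    ← integral_add hc.ofReal (hs.ofReal.mul_const _)]
  congr 1
  ext ω
  rw [← Complex.ofReal_mul, Complex.exp_mul_I]
  push_cast
  ring

theorem integrable_ofReal_mul_exp {S Z : Ω → ℝ} (hS : Integrable S P) (hZ : Measurable Z) (t : ℝ) :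
    Integrable (fun ω => (S ω : ℂ) * Complex.exp (t * Z ω * Complex.I)) P := by
  refine hS.ofReal.mul_bdd (c := 1) (by fun_prop) (Filter.Eventually.of_forall fun ω => ?_)
  rw [← Complex.ofReal_mul, Complex.norm_exp_ofReal_mul_I]

/-- Differentiation under the integral gives `i E[Z e^{itZ}]`; writing `Z = (Z - E Z) + E Z` and
inserting the hypothesis turns the first part into `-t E[Q e^{itZ}]`. -/
theorem hasDerivAt_charFun_map_of_stein [IsProbabilityMeasure P] {Z Q : Ω → ℝ}
    (hZm : Measurable Z) (hZ : MemLp Z 2 P)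
    (h : ∀ t : ℝ, ∫ ω, ((Z ω - ∫ ω, Z ω ∂P : ℝ) : ℂ) * Complex.exp (t * Z ω * Complex.I) ∂P =
      Complex.I * t * ∫ ω, (Q ω : ℂ) * Complex.exp (t * Z ω * Complex.I) ∂P) (t : ℝ) :
    HasDerivAt (charFun (P.map Z))
      (Complex.I * (∫ ω, Z ω ∂P : ℝ) * charFun (P.map Z) t
        - t * ∫ ω, (Q ω : ℂ) * Complex.exp (t * Z ω * Complex.I) ∂P) t := by
  have : IsProbabilityMeasure (P.map Z) := Measure.isProbabilityMeasure_map hZm.aemeasurable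
  have hZi : Integrable Z P := hZ.integrable (by norm_num)
  have hid : MemLp id 1 (P.map Z) := by
    rw [memLp_map_measure_iff aestronglyMeasurable_id hZm.aemeasurable, memLp_one_iff_integrable]
    exact hZi
  have h1 := hasDerivAt_charFun hid t
  rw [integral_map hZm.aemeasurable (by fun_prop)] at h1
  rw [charFun_apply_real, integral_map hZm.aemeasurable (by fun_prop)]
  convert h1 using 1
  set m := ∫ ω, Z ω ∂P with hm
  have h2 := integrable_ofReal_mul_exp hZi hZm t
  have h3 : Integrable (fun ω => (m : ℂ) * Complex.exp (t * Z ω * Complex.I)) P :=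
    integrable_ofReal_mul_exp (integrable_const m) hZm t
  have h4 := h t
  simp only [Complex.ofReal_sub, sub_mul] at h4
  rw [integral_sub h2 h3, integral_const_mul] at h4
  rw [sub_eq_iff_eq_add.1 h4, mul_add, ← mul_assoc, ← mul_assoc, ← mul_assoc, Complex.I_mul_I]
  ring

theorem evariance_condExp_eq_zero_of_hasGaussianLaw [IsProbabilityMeasure P] {Z Q : Ω → ℝ}
    (hZm : Measurable Z) (hZ : MemLp Z 2 P) (hQ : Integrable Q P)
    (h : ∀ t : ℝ, ∫ ω, ((Z ω - ∫ ω, Z ω ∂P : ℝ) : ℂ) * Complex.exp (t * Z ω * Complex.I) ∂P =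
      Complex.I * t * ∫ ω, (Q ω : ℂ) * Complex.exp (t * Z ω * Complex.I) ∂P)
    (hG : HasGaussianLaw Z P) :
    evariance (condExp (MeasurableSpace.comap Z inferInstance) P Q) P = 0 := by
  set v : ℝ := (Var[Z; P].toNNReal : ℝ) with hv
  set m : ℝ := ∫ ω, Z ω ∂P with hm
  have hψ : charFun (P.map Z) = fun t : ℝ => Complex.exp (t * m * Complex.I - v * t ^ 2 / 2) := by
    ext t
    rw [hG.map_eq_gaussianReal, charFun_gaussianReal]
  have hRi : Integrable (fun ω => Q ω - v) P := hQ.sub (integrable_const v)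
  -- Comparing the two expressions for the derivative leaves a factor `t`, so `t = 0` is excluded
  -- here and recovered below by continuity.
  have key : ∀ t : ℝ, t ≠ 0 →
      ∫ ω, ((Q ω - v : ℝ) : ℂ) * Complex.exp (t * Z ω * Complex.I) ∂P = 0 := by
    intro t ht
    have h1 := hasDerivAt_charFun_map_of_stein hZm hZ h t
    have h2 : HasDerivAt (charFun (P.map Z))
        (charFun (P.map Z) t * (m * Complex.I - v * t)) t := by
      rw [hψ]
      have e1 : HasDerivAt (fun t : ℝ => (t : ℂ)) 1 t := Complex.ofRealCLM.hasDerivAt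
      have e2 := (((e1.mul_const (m : ℂ)).mul_const Complex.I).sub
        (((e1.pow 2).const_mul (v : ℂ)).div_const 2)).cexp
      convert! e2 using 1
      simp
      ring
    have h3 := h1.unique h2
    simp only [Complex.ofReal_sub, sub_mul]
    rw [integral_sub (integrable_ofReal_mul_exp hQ hZm t)
      (integrable_ofReal_mul_exp (integrable_const v) hZm t), integral_const_mul]
    have h4 : charFun (P.map Z) t = ∫ ω, Complex.exp (t * Z ω * Complex.I) ∂P := by
      rw [charFun_apply_real, integral_map hZm.aemeasurable (by fun_prop)]
    rw [← h4]
    refine (mul_eq_zero.1 (?_ : (t : ℂ) * _ = 0)).resolve_left (by exact_mod_cast ht)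
    linear_combination -h3
  have hcont : Continuous fun t : ℝ =>
      ∫ ω, ((Q ω - v : ℝ) : ℂ) * Complex.exp (t * Z ω * Complex.I) ∂P := by
    refine continuous_of_dominated (bound := fun ω => ‖Q ω - v‖)
      (fun t => (integrable_ofReal_mul_exp hRi hZm t).aestronglyMeasurable) (fun t => ?_)
      hRi.norm (Filter.Eventually.of_forall fun ω => by fun_prop)
    refine Filter.Eventually.of_forall fun ω => ?_
    rw [norm_mul, ← Complex.ofReal_mul, Complex.norm_exp_ofReal_mul_I, mul_one, Complex.norm_real]
  have key' : ∀ t : ℝ, ∫ ω, ((Q ω - v : ℝ) : ℂ) * Complex.exp (t * Z ω * Complex.I) ∂P = 0 := by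
    have := hcont.ext_on (dense_compl_singleton (0 : ℝ)) continuous_const
      (fun t ht => key t (by simpa using ht))
    exact fun t => congrFun this t
  have hle : MeasurableSpace.comap Z inferInstance ≤ (inferInstance : MeasurableSpace Ω) :=
    hZm.comap_le
  have hae : (fun _ => v) =ᵐ[P] condExp (MeasurableSpace.comap Z inferInstance) P Q := by
    refine ae_eq_condExp_of_forall_setIntegral_eq hle hQ
      (fun s _ _ => (integrable_const v).integrableOn) ?_ aestronglyMeasurable_const
    -- Events of the σ-field of `Z` are preimages `Z ⁻¹' A`, so Fourier uniqueness tested on the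
    -- indicator of `A` is the defining property of the conditional expectation.
    rintro _ ⟨A, hA, rfl⟩ -
    have h1 := integral_mul_comp_eq_zero_of_charFunDual hRi hZm.aemeasurable (fun L => ?_)
      (f := A.indicator fun _ => (1 : ℝ)) (measurable_const.indicator hA) (C := 1) (fun x => ?_)
    · have h2 : ∀ ω, (Q ω - v) * A.indicator (fun _ => (1 : ℝ)) (Z ω) =
          (Z ⁻¹' A).indicator (fun ω => Q ω - v) ω := fun ω => by
        by_cases hω : Z ω ∈ A <;> simp [hω]
      simp only [h2] at h1
      rw [integral_indicator (hZm hA), integral_sub hQ.integrableOn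
        (integrable_const v).integrableOn] at h1
      linarith
    · rw [← key' (L 1)]
      congr 1; ext ω
      have : L (Z ω) = L 1 * Z ω := by
        conv_lhs => rw [← mul_one (Z ω), ← smul_eq_mul, map_smul, smul_eq_mul, mul_comm]
      rw [this]; push_cast; rfl
    · by_cases hx : x ∈ A <;> simp [hx]
  rw [evariance_congr hae.symm]
  rw [evariance_eq_zero_iff aemeasurable_const]
  simp

theorem integral_mul_comp_of_condExp_ae_eq_const [IsFiniteMeasure P] {Z Q : Ω → ℝ} {c : ℝ}
    (hZm : Measurable Z) (hQ : Integrable Q P)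
    (hv : condExp (MeasurableSpace.comap Z inferInstance) P Q =ᵐ[P] fun _ => c)
    {f : ℝ → ℝ} (hf : Measurable f) {C : ℝ} (hC : ∀ x, ‖f x‖ ≤ C) :
    ∫ ω, Q ω * f (Z ω) ∂P = ∫ ω, c * f (Z ω) ∂P := by
  have h1 := condExp_mul_of_stronglyMeasurable_right (m := MeasurableSpace.comap Z inferInstance)
    (μ := P) (f := Q) (g := fun ω => f (Z ω)) (hf.comp (comap_measurable Z)).stronglyMeasurable
    (hQ.mul_bdd (hf.comp hZm).aestronglyMeasurable (Filter.Eventually.of_forall fun ω => hC _)) hQ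
  have h2 := integral_condExp (μ := P) (f := Q * fun ω => f (Z ω)) hZm.comap_le
  rw [integral_congr_ae h1] at h2
  refine h2.symm.trans (integral_congr_ae ?_)
  filter_upwards [hv] with ω hω
  rw [Pi.mul_apply, hω]

theorem hasGaussianLaw_of_evariance_condExp_eq_zero [IsProbabilityMeasure P] {Z Q : Ω → ℝ}
    (hZm : Measurable Z) (hZ : MemLp Z 2 P) (hQ : Integrable Q P)
    (h : ∀ t : ℝ, ∫ ω, ((Z ω - ∫ ω, Z ω ∂P : ℝ) : ℂ) * Complex.exp (t * Z ω * Complex.I) ∂P =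
      Complex.I * t * ∫ ω, (Q ω : ℂ) * Complex.exp (t * Z ω * Complex.I) ∂P)
    (hv : evariance (condExp (MeasurableSpace.comap Z inferInstance) P Q) P = 0) :
    HasGaussianLaw Z P := by
  have hprob : IsProbabilityMeasure (P.map Z) := Measure.isProbabilityMeasure_map hZm.aemeasurable
  rw [evariance_eq_zero_iff integrable_condExp.aemeasurable] at hv
  set c : ℝ := ∫ ω, (condExp (MeasurableSpace.comap Z inferInstance) P Q) ω ∂P with hc
  set m : ℝ := ∫ ω, Z ω ∂P with hm
  have hbdd : ∀ (f : ℝ → ℝ) (_ : Measurable f) (_ : ∀ x, ‖f x‖ ≤ 1),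
      ∫ ω, Q ω * f (Z ω) ∂P = ∫ ω, c * f (Z ω) ∂P := fun f hf hf1 =>
    integral_mul_comp_of_condExp_ae_eq_const hZm hQ hv hf hf1
  have hQc : ∀ t : ℝ, ∫ ω, (Q ω : ℂ) * Complex.exp (t * Z ω * Complex.I) ∂P =
      c * charFun (P.map Z) t := by
    intro t
    have h4 : charFun (P.map Z) t = ∫ ω, Complex.exp (t * Z ω * Complex.I) ∂P := by
      rw [charFun_apply_real, integral_map hZm.aemeasurable (by fun_prop)]
    rw [h4, ← integral_const_mul, integral_ofReal_mul_exp hQ hZm,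
      integral_ofReal_mul_exp (integrable_const c) hZm,
      hbdd (fun x => Real.cos (t * x)) (by fun_prop) fun x => Real.abs_cos_le_one _,
      hbdd (fun x => Real.sin (t * x)) (by fun_prop) fun x => Real.abs_sin_le_one _]
  have hψ : ∀ t, charFun (P.map Z) t = Complex.exp (t * m * Complex.I - c * t ^ 2 / 2) := by
    -- The equation `ψ' = (i m - c t) ψ` is solved with an integrating factor: the quotient by the
    -- expected solution has derivative zero and equals one at the origin.
    have hd : ∀ t : ℝ, HasDerivAt (fun t : ℝ => charFun (P.map Z) t *
        Complex.exp (-(t * m * Complex.I - c * t ^ 2 / 2))) 0 t := by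
      intro t
      have h1 := hasDerivAt_charFun_map_of_stein hZm hZ h t
      rw [hQc] at h1
      have e1 : HasDerivAt (fun t : ℝ => (t : ℂ)) 1 t := Complex.ofRealCLM.hasDerivAt
      have e2 := (((e1.mul_const (m : ℂ)).mul_const Complex.I).sub
        (((e1.pow 2).const_mul (c : ℂ)).div_const 2)).neg.cexp
      convert! h1.mul e2 using 1
      simp
      ring
    intro t
    have h0 := is_const_of_deriv_eq_zero (fun t => (hd t).differentiableAt)
      (fun t => (hd t).deriv) t 0
    simp only [charFun_zero] at h0
    rw [Complex.exp_neg] at h0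
    have hne := Complex.exp_ne_zero (t * m * Complex.I - c * t ^ 2 / 2)
    rw [mul_inv_eq_iff_eq_mul₀ hne] at h0
    simpa using h0
  -- At `t = 1` the modulus is `e^{-c/2}`, which must not exceed one. The value `c = 0` is allowed
  -- and gives a constant `Z`.
  have hc0 : 0 ≤ c := by
    have h1 := norm_charFun_le_one (μ := P.map Z) (1 : ℝ)
    rw [hψ, Complex.norm_exp, Real.exp_le_one_iff] at h1
    simp at h1
    linarith
  have hmap : P.map Z = gaussianReal m c.toNNReal := by
    refine Measure.ext_of_charFun (funext fun t => ?_)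
    rw [hψ, charFun_gaussianReal, Real.coe_toNNReal _ hc0]
  exact ⟨by rw [hmap]; infer_instance⟩

end Stein

end Malliavin

/-! ### Chain rule in dual form and the integration by parts formula for `Z`. -/

namespace Malliavin

variable {Ω H : Type*} [MeasurableSpace Ω] [NormedAddCommGroup H] [InnerProductSpace ℝ H]
  {P : Measure Ω} {X : H → Ω → ℝ}

omit [InnerProductSpace ℝ H] in
theorem chaosProj_zero_ae_eq [IsProbabilityMeasure P] (G : Lp ℝ 2 P) :
    chaosProj X P 0 G =ᵐ[P] fun _ => ∫ ω, G ω ∂P := by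
  have hm : MemLp (fun _ : Ω => (1 : ℝ)) 2 P := memLp_const 1
  set one : Lp ℝ 2 P := hm.toLp with hone
  have h1 : wienerChaos X P 0 ≤ Submodule.span ℝ {one} := by
    refine Submodule.topologicalClosure_minimal _ (Submodule.span_le.2 ?_)
      (Submodule.closed_of_finiteDimensional _)
    rintro F ⟨h, -, hF⟩
    have : F = one := by
      ext1
      filter_upwards [hF, hm.coeFn_toLp] with ω e1 e2
      rw [e1, e2]; simp
    rw [this]
    exact Submodule.mem_span_singleton_self _
  have h2 : one ∈ wienerChaos X P 0 := by
    refine Submodule.le_topologicalClosure _ (Submodule.subset_span ⟨0, Or.inl rfl, ?_⟩)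
    filter_upwards [hm.coeFn_toLp] with ω e2
    rw [e2]; simp
  obtain ⟨c, hc⟩ := Submodule.mem_span_singleton.1 (h1 (chaosProj_mem (X := X) 0 G))
  have h3 : ∀ F : Lp ℝ 2 P, ⟪one, F⟫ = ∫ ω, F ω ∂P := fun F => by
    rw [L2.inner_def]
    refine integral_congr_ae ?_
    filter_upwards [hm.coeFn_toLp] with ω e2
    rw [e2]; simp
  have hae : chaosProj X P 0 G =ᵐ[P] fun _ => c := by
    rw [← hc]
    filter_upwards [Lp.coeFn_smul c one, hm.coeFn_toLp] with ω e1 e2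
    rw [e1, Pi.smul_apply, e2]; simp
  have h4 := inner_chaosProj h2 G
  rw [h3, h3, integral_congr_ae hae] at h4
  rw [← h4]
  simpa using hae

open Filter Topology in
/-- Chain rule in dual form: if `B` is the divergence of `V`, then
`E[φ'(F) ⟪DF, V⟫] = E[φ(F) B]`. -/
theorem integral_deriv_comp_mul_inner (hX : IsIsonormal X P) {V : Lp H 2 P} {B : Lp ℝ 2 P}
    (hVB : ∀ p ∈ derivGraph X P, ⟪p.2, V⟫ = ⟪p.1, B⟫) (hB : ∫ ω, B ω ∂P = 0)
    {φ : ℝ → ℝ} (hφ : ContDiff ℝ (⊤ : ℕ∞) φ) {C : ℝ} (hC : ∀ x, ‖φ x‖ ≤ C)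
    (hC' : ∀ x, ‖_root_.deriv φ x‖ ≤ C) {p : Lp ℝ 2 P × Lp H 2 P} (hp : p ∈ derivGraph X P) :
    ∫ ω, _root_.deriv φ (p.1 ω) * ⟪p.2 ω, V ω⟫ ∂P = ∫ ω, φ (p.1 ω) * B ω ∂P := by
  have := hX.isGaussianProcess.isProbabilityMeasure
  have hcφ : Continuous φ := hφ.continuous
  have hcd : Continuous (_root_.deriv φ) := hφ.continuous_deriv (by simp)
  have hBi : Integrable B P := (Lp.memLp B).integrable (by norm_num)
  have hm1 : ∀ F : Lp ℝ 2 P, AEStronglyMeasurable (fun ω => φ (F ω)) P := fun F =>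
    hcφ.comp_aestronglyMeasurable (Lp.aestronglyMeasurable F)
  have hm2 : ∀ F : Lp ℝ 2 P, AEStronglyMeasurable (fun ω => _root_.deriv φ (F ω)) P := fun F =>
    hcd.comp_aestronglyMeasurable (Lp.aestronglyMeasurable F)
  have hI : ∀ U : Lp H 2 P, Integrable (fun ω => ⟪U ω, V ω⟫) P := fun U => L2.integrable_inner U V
  refine derivGraph_induction hX (C := {p : Lp ℝ 2 P × Lp H 2 P |
    ∫ ω, _root_.deriv φ (p.1 ω) * ⟪p.2 ω, V ω⟫ ∂P = ∫ ω, φ (p.1 ω) * B ω ∂P}) ?_ ?_ hp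
  · refine IsSeqClosed.isClosed fun q p hq hqp => ?_
    obtain ⟨ns, hns, hae⟩ := (tendstoInMeasure_of_tendsto_Lp
      ((continuous_fst.tendsto p).comp hqp)).exists_seq_tendsto_ae
    have hR : Tendsto (fun k => ∫ ω, φ ((q (ns k)).1 ω) * B ω ∂P) atTop
        (𝓝 (∫ ω, φ (p.1 ω) * B ω ∂P)) := by
      refine tendsto_integral_of_dominated_convergence (fun ω => C * ‖B ω‖)
        (fun k => (hm1 _).mul hBi.aestronglyMeasurable) (hBi.norm.const_mul C)
        (fun k => Eventually.of_forall fun ω => ?_) ?_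
      · rw [norm_mul]; gcongr; exact hC _
      · filter_upwards [hae] with ω hω
        exact ((hcφ.tendsto _).comp hω).mul_const _
    have hL1 : Tendsto (fun k => ∫ ω, _root_.deriv φ ((q (ns k)).1 ω) * ⟪p.2 ω, V ω⟫ ∂P) atTop
        (𝓝 (∫ ω, _root_.deriv φ (p.1 ω) * ⟪p.2 ω, V ω⟫ ∂P)) := by
      refine tendsto_integral_of_dominated_convergence (fun ω => C * ‖⟪p.2 ω, V ω⟫‖)
        (fun k => (hm2 _).mul (hI p.2).aestronglyMeasurable) ((hI p.2).norm.const_mul C)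
        (fun k => Eventually.of_forall fun ω => ?_) ?_
      · rw [norm_mul]; gcongr; exact hC' _
      · filter_upwards [hae] with ω hω
        exact ((hcd.tendsto _).comp hω).mul_const _
    -- The second components converge only in `L²`; their error is controlled by Cauchy-Schwarz,
    -- using just the bound on `φ'`.
    have hL2 : Tendsto (fun k => ∫ ω, _root_.deriv φ ((q (ns k)).1 ω) *
        ⟪((q (ns k)).2 - p.2 : Lp H 2 P) ω, V ω⟫ ∂P) atTop (𝓝 0) := by
      refine squeeze_zero_norm (a := fun k => C * (‖(q (ns k)).2 - p.2‖ * ‖V‖)) (fun k => ?_) ?_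
      · have hn : ∀ U : Lp H 2 P, ∫ ω, ‖U ω‖ * ‖V ω‖ ∂P ≤ ‖U‖ * ‖V‖ := fun U => by
          have h1 := real_inner_le_norm (Lp.memLp U).norm.toLp (Lp.memLp V).norm.toLp
          rw [Lp.norm_toLp, Lp.norm_toLp, eLpNorm_norm, eLpNorm_norm, ← Lp.norm_def,
            ← Lp.norm_def, L2.inner_def] at h1
          refine le_trans (le_of_eq (integral_congr_ae ?_)) h1
          filter_upwards [(Lp.memLp U).norm.coeFn_toLp, (Lp.memLp V).norm.coeFn_toLp] with ω e1 e2
          rw [e1, e2]; simp [mul_comm]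
        have hC0 : 0 ≤ C := (norm_nonneg _).trans (hC 0)
        refine (norm_integral_le_integral_norm _).trans ?_
        refine le_trans ?_ (mul_le_mul_of_nonneg_left (hn _) hC0)
        rw [← integral_const_mul]
        refine integral_mono_of_nonneg (Eventually.of_forall fun ω => norm_nonneg _)
          (((Lp.memLp _).norm.integrable_mul (Lp.memLp V).norm).const_mul C)
          (Eventually.of_forall fun ω => ?_)
        simp only [norm_mul]
        gcongr
        · exact hC' _
        · exact norm_inner_le_norm _ _
      · have h1 : Tendsto (fun k => (q (ns k)).2 - p.2) atTop (𝓝 0) := by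
          have := ((continuous_snd.tendsto p).comp (hqp.comp hns.tendsto_atTop)).sub_const p.2
          simpa [Function.comp_def] using this
        simpa using (h1.norm.mul_const ‖V‖).const_mul C
    have hL := hL2.add hL1
    rw [zero_add] at hL
    refine tendsto_nhds_unique (hL.congr fun k => ?_) hR
    rw [← hq (ns k), ← integral_add ((hI _).bdd_mul (hm2 _) (Eventually.of_forall fun ω => hC' _))
      ((hI _).bdd_mul (hm2 _) (Eventually.of_forall fun ω => hC' _))]
    refine integral_congr_ae ?_
    filter_upwards [Lp.coeFn_sub (q (ns k)).2 p.2] with ω hω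
    rw [hω, Pi.sub_apply, inner_sub_left]
    ring
  · rintro ⟨F, U⟩ ⟨n, ψ, f, hn, hf, hfs, hF, hU⟩
    simp only at hF hU
    change ∫ ω, _root_.deriv φ (F ω) * ⟪U ω, V ω⟫ ∂P = ∫ ω, φ (F ω) * B ω ∂P
    -- Subtracting `φ 0` keeps the composition with `f` compactly supported; the constant is
    -- harmless because `B` has mean zero.
    have mF : MemLp (fun ω => φ (F ω) - φ 0) 2 P :=
      (MemLp.of_bound (hm1 F) C (Eventually.of_forall fun ω => hC _)).sub (memLp_const _)
    have mU : MemLp (fun ω => _root_.deriv φ (F ω) • U ω) 2 P :=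
      (Lp.memLp U).of_le_mul (c := C) ((hm2 F).smul (Lp.aestronglyMeasurable U))
        (Eventually.of_forall fun ω => by rw [norm_smul]; gcongr; exact hC' _)
    have hq : (mF.toLp, mU.toLp) ∈ derivGraph X P := by
      rw [← SetLike.mem_coe, coe_derivGraph hX]
      refine subset_closure ⟨n, ψ, fun x => φ (f x) - φ 0, hn,
        (hφ.comp hf).sub contDiff_const, ?_, ?_, ?_⟩
      · exact hfs.comp_left (g := fun y => φ y - φ 0) (by simp)
      · filter_upwards [mF.coeFn_toLp, hF] with ω e1 e2
        rw [e1, e2]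
      · filter_upwards [mU.coeFn_toLp, hF, hU] with ω e1 e2 e3
        rw [e1, e2, e3, Finset.smul_sum]
        refine Finset.sum_congr rfl fun i _ => ?_
        have d1 := (hf.differentiable (by simp) (fun j => X (ψ j) ω)).hasFDerivAt
        have d2 := (hφ.differentiable (by simp) (f fun j => X (ψ j) ω)).hasDerivAt
        have d3 : fderiv ℝ (fun x => φ (f x) - φ 0) (fun j => X (ψ j) ω) = _ :=
          ((d2.comp_hasFDerivAt _ d1).sub_const (φ 0)).fderiv
        rw [d3]
        simp [smul_smul]
    have h1 := hVB _ hq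
    simp only [L2.inner_def] at h1
    have e1 : ∫ ω, ⟪(mU.toLp _ : Lp H 2 P) ω, V ω⟫ ∂P = ∫ ω, _root_.deriv φ (F ω) * ⟪U ω, V ω⟫ ∂P := by
      refine integral_congr_ae ?_
      filter_upwards [mU.coeFn_toLp] with ω e
      rw [e, real_inner_smul_left]
    have e2 : ∫ ω, ⟪(mF.toLp _ : Lp ℝ 2 P) ω, B ω⟫ ∂P = ∫ ω, (φ (F ω) * B ω - φ 0 * B ω) ∂P := by
      refine integral_congr_ae ?_
      filter_upwards [mF.coeFn_toLp] with ω e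
      rw [e]; simp; ring
    rw [e1, e2, integral_sub (hBi.bdd_mul (hm1 F) (Eventually.of_forall fun ω => hC _))
      (hBi.const_mul _), integral_const_mul, hB, mul_zero, sub_zero] at h1
    exact h1

/-- The integration by parts formula `E[(Z - E Z) e^{itZ}] = i t E[⟪DZ, -D L⁻¹ Z⟫ e^{itZ}]`. -/
theorem integral_sub_mul_exp [CompleteSpace H] [IsProbabilityMeasure P] (hX : IsIsonormal X P)
    {Z : Ω → ℝ} (hZm : Measurable Z) (hZ : MemLp Z 2 P) (hZD : hZ.toLp Z ∈ D12 X P) (t : ℝ) :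
    ∫ ω, ((Z ω - ∫ ω, Z ω ∂P : ℝ) : ℂ) * Complex.exp (t * Z ω * Complex.I) ∂P =
      Complex.I * t * ∫ ω, (⟪deriv X P (hZ.toLp Z) ω, -(deriv X P (invL X P (hZ.toLp Z)) ω)⟫ : ℂ)
        * Complex.exp (t * Z ω * Complex.I) ∂P := by
  obtain ⟨U, hU⟩ := hZD
  rw [hasDeriv_iff hX] at hU
  obtain ⟨V, hV, hVB⟩ := exists_deriv_invL hX (hZ.toLp Z)
  rw [deriv_eq hX hU, deriv_eq hX hV]
  set m := ∫ ω, Z ω ∂P with hm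
  set B := hZ.toLp Z - chaosProj X P 0 (hZ.toLp Z) with hBdef
  have hZi : Integrable Z P := hZ.integrable (by norm_num)
  have hBae : B =ᵐ[P] fun ω => Z ω - m := by
    filter_upwards [Lp.coeFn_sub (hZ.toLp Z) (chaosProj X P 0 (hZ.toLp Z)), hZ.coeFn_toLp,
      chaosProj_zero_ae_eq (X := X) (P := P) (hZ.toLp Z)] with ω e1 e2 e3
    rw [hBdef, e1, Pi.sub_apply, e2, e3, integral_congr_ae hZ.coeFn_toLp]
  have hB0 : ∫ ω, B ω ∂P = 0 := by
    rw [integral_congr_ae hBae, integral_sub hZi (integrable_const m)]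
    simp [hm]
  have hQae : (fun ω => ⟪U ω, (-V : Lp H 2 P) ω⟫) =ᵐ[P] fun ω => ⟪U ω, -(V ω)⟫ := by
    filter_upwards [Lp.coeFn_neg V] with ω e1
    rw [e1, Pi.neg_apply]
  have hQi : Integrable (fun ω => ⟪U ω, -(V ω)⟫) P := (L2.integrable_inner U (-V)).congr hQae
  -- The chain rule is stated for real functions, so it is applied to `cos (t y)` and `sin (t y)`
  -- separately; `1 + |t|` bounds both functions and their derivatives.
  have chain : ∀ (φ : ℝ → ℝ) (C : ℝ), ContDiff ℝ (⊤ : ℕ∞) φ → (∀ x, ‖φ x‖ ≤ C) →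
      (∀ x, ‖_root_.deriv φ x‖ ≤ C) →
      ∫ ω, (Z ω - m) * φ (Z ω) ∂P = ∫ ω, ⟪U ω, -(V ω)⟫ * _root_.deriv φ (Z ω) ∂P := by
    intro φ C h1 h2 h3
    have h4 := integral_deriv_comp_mul_inner hX hVB hB0 h1 h2 h3 hU
    refine Eq.trans (integral_congr_ae ?_) (h4.symm.trans (integral_congr_ae ?_))
    · filter_upwards [hBae, hZ.coeFn_toLp] with ω e1 e2
      rw [e1, e2, mul_comm]
    · filter_upwards [hQae, hZ.coeFn_toLp] with ω e1 e2
      rw [e1, e2, mul_comm]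
  have hmul : ∀ x : ℝ, HasDerivAt (fun y => t * y) t x := fun x => by
    simpa using (hasDerivAt_id x).const_mul t
  have dcos : ∀ x, _root_.deriv (fun y => Real.cos (t * y)) x = -Real.sin (t * x) * t := fun x =>
    (hmul x).cos.deriv
  have dsin : ∀ x, _root_.deriv (fun y => Real.sin (t * y)) x = Real.cos (t * x) * t := fun x =>
    (hmul x).sin.deriv
  have ht : 1 ≤ 1 + |t| := by linarith [abs_nonneg t]
  have hcos := chain (fun y => Real.cos (t * y)) (1 + |t|)
    (Real.contDiff_cos.comp (contDiff_const.mul contDiff_id))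
    (fun x => (Real.abs_cos_le_one _).trans ht) (fun x => by
      rw [dcos, norm_mul, norm_neg, Real.norm_eq_abs, Real.norm_eq_abs]
      nlinarith [Real.abs_sin_le_one (t * x), abs_nonneg t])
  have hsin := chain (fun y => Real.sin (t * y)) (1 + |t|)
    (Real.contDiff_sin.comp (contDiff_const.mul contDiff_id))
    (fun x => (Real.abs_sin_le_one _).trans ht) (fun x => by
      rw [dsin, norm_mul, Real.norm_eq_abs, Real.norm_eq_abs]
      nlinarith [Real.abs_cos_le_one (t * x), abs_nonneg t])
  simp only [dcos, dsin, ← mul_assoc, mul_neg, neg_mul] at hcos hsin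
  rw [integral_neg, integral_mul_const] at hcos
  rw [integral_mul_const] at hsin
  rw [integral_ofReal_mul_exp (S := fun ω => Z ω - m) (hZi.sub (integrable_const m)) hZm,
    integral_ofReal_mul_exp hQi hZm]
  rw [hcos, hsin]
  push_cast
  linear_combination (-((∫ ω, ⟪U ω, -(V ω)⟫ * Real.sin (t * Z ω) ∂P : ℝ) : ℂ) * t) *
    Complex.I_mul_I

theorem integrable_inner_deriv (F G : Lp ℝ 2 P) :
    Integrable (fun ω => ⟪deriv X P F ω, -(deriv X P G ω)⟫) P := by
  refine (L2.integrable_inner (𝕜 := ℝ) (deriv X P F) (-deriv X P G)).congr ?_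
  filter_upwards [Lp.coeFn_neg (deriv X P G)] with ω e1
  rw [e1, Pi.neg_apply]

end Malliavin

end

theorem corollary3p3 {Ω H : Type*} [MeasurableSpace Ω]
    [NormedAddCommGroup H] [InnerProductSpace ℝ H] [CompleteSpace H]
    [TopologicalSpace.SeparableSpace H]
    (P : Measure Ω) [IsProbabilityMeasure P]
    (X : H → Ω → ℝ) (hX : Malliavin.IsIsonormal X P)
    (Z : Ω → ℝ) (hZm : Measurable Z) (hZ : MemLp Z 2 P)
    (hZD : hZ.toLp Z ∈ Malliavin.D12 X P) :
    HasGaussianLaw Z P ↔ evariance (Malliavin.gOf X P Z hZ) P = 0 := by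
  have hQ := Malliavin.integrable_inner_deriv (X := X) (hZ.toLp Z)
    (Malliavin.invL X P (hZ.toLp Z))
  have h := Malliavin.integral_sub_mul_exp hX hZm hZ hZD
  exact ⟨Malliavin.evariance_condExp_eq_zero_of_hasGaussianLaw hZm hZ hQ h,
    Malliavin.hasGaussianLaw_of_evariance_condExp_eq_zero hZm hZ hQ h⟩
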